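/- Let $(g_\varepsilon,u_\varepsilon,T_\varepsilon)$, $|\varepsilon|<\varepsilon_0$, be a smooth one-parameter family of spacetimes on a coordinate patch $U$: $g_\varepsilon$ is a Lorentzian metric of signature $(-,+,+,+)$, $u_\varepsilon$ is a vector field with $u^au_a=-1$, and $T_{ab}=G_{ab}$ (Einstein equations, $c=8\pi G=1$, general matter). Let the member $\varepsilon=0$ be an FLRW spacetime $$ds^2=-dt^2+\frac{a^2(t)}{1-kr^2}\,dr^2+r^2a^2(t)\,(d\theta^2+\sin^2\theta\,d\phi^2),\qquad u_0=\partial_t .$$ Write $h_{ab}=g_{ab}+u_au_b$, let a dot denote $u^e\nabla_e$, let $D$ be the covariant derivative totally projected with $h$, and let angle brackets denote the projected symmetric trace-free part. Put $\Theta=D_au^a$, $\sigma_{ab}=D_{\langle a}u_{b\rangle}$, $\omega^a=\epsilon^{abc}D_bu_c$ (with $\epsilon_{abc}$ the spatial volume element orthogonal to $u^a$), $\mu=T_{ab}u^au^b$, $p=\frac13h^{ab}T_{ab}$, $q_a=-h^c{}_aT_{cd}u^d$. Write $X\simeq Y$ if $X-Y=o(\varepsilon)$ as $\varepsilon\to0$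 (equality in the linearised regime), at each point of $U$ and for all components. Suppose that the perturbation is conformally flat, $C_{abcd}\simeq0$ (Weyl tensor), and restricted to tensor modes: $\dot u_a\simeq0$, $\omega^a\simeq0$, $q_a\simeq0$, $D_a\Theta\simeq0$, $D_a\mu\simeq0$, $D_ap\simeq0$. Then the shear obeys a closed transverse-traceless tensor wave equation: $\sigma_{ab}$ is symmetric, $\sigma_{ab}u^b=0$, $\sigma^a{}_a=0$, $D^b\sigma_{ab}\simeq0$, and, with $D^2=D^cD_c$, $$\ddot\sigma_{\langle ab\rangle}-D^2\sigma_{ab}\simeq-\Theta\,\dot\sigma_{\langle ab\rangle}+\left(\tfrac13\Theta^2-\tfrac76\mu+\tfrac12p\right)\sigma_{ab}.$$ -/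

import Mathlib

open scoped ContDiff Topology

noncomputable section

namespace ConfFlat

/-- Points of a coordinate patch `(x⁰, x¹, x², x³)` of spacetime. -/
abbrev Pt := Fin 4 → ℝ

/-- A vector or covector field, given by its components in the patch. -/
abbrev Field1 := Pt → Fin 4 → ℝ

/-- A covariant tensor field of rank two, by components. -/
abbrev Field2 := Pt → Fin 4 → Fin 4 → ℝ

/-- A covariant tensor field of rank three, by components. -/
abbrev Field3 := Pt → Fin 4 → Fin 4 → Fin 4 → ℝ

/-- A metric (or other matrix-valued) field `g_ab`. -/
abbrev MetricField := Pt → Matrix (Fin 4) (Fin 4) ℝ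

/-- The partial derivative `∂_c f`. -/
def pd (c : Fin 4) (f : Pt → ℝ) (x : Pt) : ℝ := fderiv ℝ f x (Pi.single c 1)

/-! ### Curvature of a metric -/

/-- Christoffel symbols `Γ^a_{bc}` of the Levi-Civita connection. -/
def christoffel (g : MetricField) (x : Pt) (a b c : Fin 4) : ℝ :=
  (1 / 2) * ∑ d, (g x)⁻¹ a d *
    (pd b (fun y => g y d c) x + pd c (fun y => g y d b) x - pd d (fun y => g y b c) x)

/-- `R^a_{bcd} = Γ^a_{bd,c} - Γ^a_{bc,d} + Γ^e_{bd} Γ^a_{ce} - Γ^e_{bc} Γ^a_{de}`. -/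
def riemannUp (g : MetricField) (x : Pt) (a b c d : Fin 4) : ℝ :=
  pd c (fun y => christoffel g y a b d) x - pd d (fun y => christoffel g y a b c) x
    + ∑ e, christoffel g x e b d * christoffel g x a c e
    - ∑ e, christoffel g x e b c * christoffel g x a d e

/-- `R_{abcd}`. -/
def riemann (g : MetricField) (x : Pt) (a b c d : Fin 4) : ℝ :=
  ∑ e, g x a e * riemannUp g x e b c d

/-- `R_{ab} = g^{cd} R_{cadb}`. -/
def ricci (g : MetricField) (x : Pt) (a b : Fin 4) : ℝ :=
  ∑ c, ∑ d, (g x)⁻¹ c d * riemann g x c a d b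

/-- The Ricci scalar. -/
def scalarCurv (g : MetricField) (x : Pt) : ℝ :=
  ∑ a, ∑ b, (g x)⁻¹ a b * ricci g x a b

/-- The Einstein tensor `G_{ab}`. -/
def einstein (g : MetricField) (x : Pt) (a b : Fin 4) : ℝ :=
  ricci g x a b - (1 / 2) * scalarCurv g x * g x a b

/-- The Weyl tensor `C_{abcd}` in four dimensions. -/
def weyl (g : MetricField) (x : Pt) (a b c d : Fin 4) : ℝ :=
  riemann g x a b c d
    - (1 / 2) * (g x a c * ricci g x b d - g x a d * ricci g x b c
        - g x b c * ricci g x a d + g x b d * ricci g x a c)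
    + (1 / 6) * scalarCurv g x * (g x a c * g x b d - g x a d * g x b c)

/-! ### Covariant derivatives of covariant tensors (the derivative index comes first) -/

/-- `∇_c V_a`. -/
def nabla1 (g : MetricField) (V : Field1) : Field2 := fun x c a =>
  pd c (fun y => V y a) x - ∑ e, christoffel g x e c a * V x e

/-- `∇_c S_{ab}`. -/
def nabla2 (g : MetricField) (S : Field2) : Field3 := fun x c a b =>
  pd c (fun y => S y a b) x - ∑ e, christoffel g x e c a * S x e b
    - ∑ e, christoffel g x e c b * S x a e

/-- `∇_d S_{cab}`. -/
def nabla3 (g : MetricField) (S : Field3) (x : Pt) (d c a b : Fin 4) : ℝ :=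
  pd d (fun y => S y c a b) x - ∑ e, christoffel g x e d c * S x e a b
    - ∑ e, christoffel g x e d a * S x c e b - ∑ e, christoffel g x e d b * S x c a e

/-! ### The 1+3 splitting along a velocity field `u^a` -/

/-- `u_a = g_{ab} u^b`. -/
def low (g : MetricField) (u : Field1) : Field1 := fun x a => ∑ b, g x a b * u x b

/-- `h_{ab} = g_{ab} + u_a u_b`. -/
def hLow (g : MetricField) (u : Field1) : Field2 := fun x a b =>
  g x a b + low g u x a * low g u x b

/-- `h^a_b = δ^a_b + u^a u_b`, the upper index first. -/
def hMix (g : MetricField) (u : Field1) : Field2 := fun x a b =>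
  (if a = b then 1 else 0) + u x a * low g u x b

/-- `h^{ab} = g^{ab} + u^a u^b`. -/
def hUp (g : MetricField) (u : Field1) : Field2 := fun x a b =>
  (g x)⁻¹ a b + u x a * u x b

/-- The covariant time derivative `u^e ∇_e V_a`. -/
def dot1 (g : MetricField) (u V : Field1) : Field1 := fun x a =>
  ∑ e, u x e * nabla1 g V x e a

/-- The covariant time derivative `u^e ∇_e S_{ab}`. -/
def dot2 (g : MetricField) (u : Field1) (S : Field2) : Field2 := fun x a b =>
  ∑ e, u x e * nabla2 g S x e a b

/-- The projected gradient `D_a f` of a scalar. -/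
def D0 (g : MetricField) (u : Field1) (f : Pt → ℝ) : Field1 := fun x a =>
  ∑ b, hMix g u x b a * pd b f x

/-- The projected derivative `D_c V_a`. -/
def D1 (g : MetricField) (u V : Field1) : Field2 := fun x c a =>
  ∑ p, ∑ q, hMix g u x p c * hMix g u x q a * nabla1 g V x p q

/-- The projected derivative `D_c S_{ab}`. -/
def D2 (g : MetricField) (u : Field1) (S : Field2) : Field3 := fun x c a b =>
  ∑ p, ∑ q, ∑ r, hMix g u x p c * hMix g u x q a * hMix g u x r b * nabla2 g S x p q r

/-- The projected derivative `D_d S_{cab}`. -/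
def D3 (g : MetricField) (u : Field1) (S : Field3) (x : Pt) (d c a b : Fin 4) : ℝ :=
  ∑ o, ∑ p, ∑ q, ∑ r, hMix g u x o d * hMix g u x p c * hMix g u x q a * hMix g u x r b *
    nabla3 g S x o p q r

/-- The spatial Laplacian `D² S_{ab} = D^c D_c S_{ab}`. -/
def lap2 (g : MetricField) (u : Field1) (S : Field2) : Field2 := fun x a b =>
  ∑ c, ∑ d, hUp g u x c d * D3 g u (D2 g u S) x c d a b

/-- The spatial divergence `D^b S_{ab}`. -/
def div2 (g : MetricField) (u : Field1) (S : Field2) : Field1 := fun x a =>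
  ∑ b, ∑ c, hUp g u x b c * D2 g u S x c a b

/-- The projected symmetric trace-free part `S_{⟨ab⟩}`. -/
def pstf (g : MetricField) (u : Field1) (S : Field2) : Field2 := fun x a b =>
  (∑ c, ∑ d, hMix g u x c a * hMix g u x d b * ((S x c d + S x d c) / 2))
    - (1 / 3) * hLow g u x a b * ∑ c, ∑ d, hUp g u x c d * S x c d

/-- The permutation symbol: the determinant of the rows `δ_a, δ_b, δ_c, δ_d`. -/
def permSymbol (a b c d : Fin 4) : ℝ :=
  Matrix.det (Matrix.of fun i j : Fin 4 => if (![a, b, c, d] : Fin 4 → Fin 4) i = j then (1 : ℝ) else 0)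

/-- The spatial volume element `ε_{abc} = η_{abcd} u^d`, with `η_{0123} = -√|det g|`. -/
def epsLow (g : MetricField) (u : Field1) : Field3 := fun x a b c =>
  -Real.sqrt |(g x).det| * ∑ d, permSymbol a b c d * u x d

/-- `ε^{abc}`. -/
def epsUp (g : MetricField) (u : Field1) : Field3 := fun x a b c =>
  ∑ p, ∑ q, ∑ r, (g x)⁻¹ a p * (g x)⁻¹ b q * (g x)⁻¹ c r * epsLow g u x p q r

/-! ### Kinematical quantities -/

/-- The acceleration `u^e ∇_e u_a`. -/
def acceleration (g : MetricField) (u : Field1) : Field1 := dot1 g u (low g u)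

/-- The expansion `Θ = D_a u^a`. -/
def expansion (g : MetricField) (u : Field1) (x : Pt) : ℝ :=
  ∑ a, ∑ b, hUp g u x a b * D1 g u (low g u) x a b

/-- The shear `σ_{ab} = D_{⟨a} u_{b⟩}`. -/
def shear (g : MetricField) (u : Field1) : Field2 := pstf g u (D1 g u (low g u))

/-- The vorticity vector `ω^a = ε^{abc} D_b u_c`. -/
def vorticity (g : MetricField) (u : Field1) : Field1 := fun x a =>
  ∑ b, ∑ c, epsUp g u x a b c * D1 g u (low g u) x b c

/-- `σ̇_{⟨ab⟩}`. -/
def shearDot (g : MetricField) (u : Field1) : Field2 :=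
  pstf g u (dot2 g u (shear g u))

/-- `σ̈_{⟨ab⟩}`. -/
def shearDDot (g : MetricField) (u : Field1) : Field2 :=
  pstf g u (dot2 g u (dot2 g u (shear g u)))

/-! ### Matter quantities of an energy-momentum tensor `T_{ab}` -/

/-- The energy density `μ = T_{ab} u^a u^b`. -/
def density (T : Field2) (u : Field1) (x : Pt) : ℝ :=
  ∑ a, ∑ b, T x a b * u x a * u x b

/-- The isotropic pressure `p = h^{ab} T_{ab} / 3`. -/
def pressure (g : MetricField) (T : Field2) (u : Field1) (x : Pt) : ℝ :=
  (1 / 3) * ∑ a, ∑ b, hUp g u x a b * T x a b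

/-- The heat flux `q_a = -h^c_a T_{cd} u^d`. -/
def heatFlux (g : MetricField) (T : Field2) (u : Field1) : Field1 := fun x a =>
  -∑ c, ∑ d, hMix g u x c a * T x c d * u x d

/-! ### Perturbations of the Friedmann-Lemaitre-Robertson-Walker spacetime -/

/-- A matrix is Lorentzian if it is congruent to `diag(-1, 1, 1, 1)`. -/
def IsLorentzian (M : Matrix (Fin 4) (Fin 4) ℝ) : Prop :=
  ∃ P : Matrix (Fin 4) (Fin 4) ℝ, IsUnit P.det ∧
    M = P.transpose * Matrix.diagonal ![-1, 1, 1, 1] * P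

/-- The FLRW metric with scale factor `a` and spatial curvature `k` in the coordinates
`(t, r, θ, φ)`. -/
def flrw (a : ℝ → ℝ) (k : ℝ) : MetricField := fun x =>
  Matrix.diagonal ![-1, a (x 0) ^ 2 / (1 - k * x 1 ^ 2), x 1 ^ 2 * a (x 0) ^ 2,
    x 1 ^ 2 * a (x 0) ^ 2 * Real.sin (x 2) ^ 2]

/-- The coordinate domain of the FLRW metric. -/
def flrwDomain (a : ℝ → ℝ) (k : ℝ) : Set Pt :=
  {x | 0 < a (x 0) ∧ 0 < x 1 ∧ 0 < 1 - k * x 1 ^ 2 ∧ 0 < x 2 ∧ x 2 < Real.pi}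

/-- Two functions of the perturbation parameter agree in the linearised regime: they differ
by terms of higher than first order. -/
def EqFirstOrder (f₁ f₂ : ℝ → ℝ) : Prop :=
  (fun ε => f₁ ε - f₂ ε) =o[𝓝 0] (fun ε : ℝ => ε)

/-- A smooth one-parameter family of spacetimes `(g_ε, u_ε, T_ε)`, `|ε| < ε₀`, on a patch `U`,
each with a Lorentzian metric, a unit timelike velocity field and an energy-momentum tensor
related to the metric by the Einstein equations `G_{ab} = T_{ab}`, such that the member `ε = 0`
is the FLRW spacetime with its comoving velocity `∂_t`. -/
structure IsFLRWPerturbation (a : ℝ → ℝ) (k ε₀ : ℝ) (U : Set Pt)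
    (g : ℝ → MetricField) (u : ℝ → Field1) (T : ℝ → Field2) : Prop where
  pos : 0 < ε₀
  isOpen : IsOpen U
  subset_domain : U ⊆ flrwDomain a k
  smooth_metric : ∀ i j : Fin 4,
    ContDiffOn ℝ ∞ (fun z : ℝ × Pt => g z.1 z.2 i j) (Set.Ioo (-ε₀) ε₀ ×ˢ U)
  smooth_velocity : ∀ i : Fin 4,
    ContDiffOn ℝ ∞ (fun z : ℝ × Pt => u z.1 z.2 i) (Set.Ioo (-ε₀) ε₀ ×ˢ U)
  lorentzian : ∀ ε ∈ Set.Ioo (-ε₀) ε₀, ∀ x ∈ U, IsLorentzian (g ε x)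
  unit_timelike : ∀ ε ∈ Set.Ioo (-ε₀) ε₀, ∀ x ∈ U,
    ∑ i, ∑ j, g ε x i j * u ε x i * u ε x j = -1
  einstein_eq : ∀ ε ∈ Set.Ioo (-ε₀) ε₀, ∀ x ∈ U, ∀ i j : Fin 4,
    einstein (g ε) x i j = T ε x i j
  background_metric : ∀ x ∈ U, g 0 x = flrw a k x
  background_velocity : ∀ x ∈ U, u 0 x = Pi.single 0 1

/-- The perturbation is conformally flat: the Weyl tensor of `g_ε` vanishes to first order. In
particular this holds if it vanishes identically for each `ε`. -/
def IsConformallyFlat (U : Set Pt) (g : ℝ → MetricField) : Prop :=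
  ∀ x ∈ U, ∀ i j l m : Fin 4, EqFirstOrder (fun ε => weyl (g ε) x i j l m) (fun _ => 0)

/-- Restriction to the tensor modes: to first order the acceleration, the vorticity, the heat flux
and the spatial gradients of the scalars `Θ`, `μ`, `p` are neglected. -/
structure IsTensorMode (U : Set Pt)
    (g : ℝ → MetricField) (u : ℝ → Field1) (T : ℝ → Field2) : Prop where
  acceleration_eq : ∀ x ∈ U, ∀ i : Fin 4,
    EqFirstOrder (fun ε => acceleration (g ε) (u ε) x i) (fun _ => 0)
  vorticity_eq : ∀ x ∈ U, ∀ i : Fin 4,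
    EqFirstOrder (fun ε => vorticity (g ε) (u ε) x i) (fun _ => 0)
  heatFlux_eq : ∀ x ∈ U, ∀ i : Fin 4,
    EqFirstOrder (fun ε => heatFlux (g ε) (T ε) (u ε) x i) (fun _ => 0)
  grad_expansion : ∀ x ∈ U, ∀ i : Fin 4,
    EqFirstOrder (fun ε => D0 (g ε) (u ε) (expansion (g ε) (u ε)) x i) (fun _ => 0)
  grad_density : ∀ x ∈ U, ∀ i : Fin 4,
    EqFirstOrder (fun ε => D0 (g ε) (u ε) (density (T ε) (u ε)) x i) (fun _ => 0)
  grad_pressure : ∀ x ∈ U, ∀ i : Fin 4,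
    EqFirstOrder (fun ε => D0 (g ε) (u ε) (pressure (g ε) (T ε) (u ε)) x i) (fun _ => 0)

end ConfFlat

end

/-!
The linearised regime is turned into exact algebra. Smooth families of scalar fields on
`(-ε₀, ε₀) × U`, modulo those that are `o(ε)` at each point of `U`, form a commutative algebra
`Formal.Patch.Lin` on which the partial derivatives act as commuting derivations, because a family
is negligible exactly when it and its first derivative in `ε` vanish at `ε = 0`. The classes that
vanish in the background form an ideal `Formal.Patch.firstOrder`, stable under the derivations, in
which all products are zero. Tensor calculus makes sense over any such algebra
(`Formal.Spacetime`), and the hypotheses become equations there (`Formal.Spacetime.IsTensorMode`).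
The only property of the FLRW background that enters is that its shear vanishes
(`Formal.shear_flrw`).

Write `θ = Θ / 3`. Without acceleration and vorticity `∇_a u_b = θ h_{ab} + σ_{ab}` (`nabla_w`).
As the Weyl tensor vanishes, the curvature is `g ∧ P` with
`2 P_{ab} = π_{ab} + (μ + p) u_a u_b + μ g_{ab} / 3`, where `π_{ab}` is the anisotropic stress. The
Ricci identity for `u` then splits into the Raychaudhuri equation, the evolution equation
`π_{ab} = 2 σ̇_{ab} + 4 θ σ_{ab}` (`stress_eq`; in particular the stress is of first order), and the
Codazzi equation (`codazzi`), whose trace is `D^b σ_{ab} = 0`.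

The second Bianchi identity makes the Cotton tensor vanish (`cotton`), whose time component is
`π̇_{ab} = -θ π_{ab} - (μ + p) σ_{ab}` (`dot_stress`). Eliminating the stress gives
`σ̈_{ab} = -3 θ σ̇_{ab} + (-μ / 6 + p / 2) σ_{ab}` (`ddot_shear`). On the other hand the Codazzi
equation exchanges the derivative index in `D^c D_c σ_{ab}` with an index of the shear; a
commutator, evaluated by the Ricci identity for `σ`, and a vanishing divergence remain, and
`D² σ_{ab} = (μ - 3 θ²) σ_{ab}` (`lap2_shear`). The difference of the two is the wave equation.
-/

noncomputable section

namespace Formal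

/-- A spacetime with a unit timelike velocity field, seen in coordinates, whose scalar fields form
an arbitrary commutative real algebra `A` with commuting derivations `∂_0, …, ∂_3`. -/
structure Spacetime (A : Type*) [CommRing A] [Algebra ℝ A] where
  /-- The coordinate derivations `∂_c`. -/
  d : Fin 4 → Derivation ℝ A A
  /-- The metric `g_{ab}`. -/
  g : Fin 4 → Fin 4 → A
  /-- The inverse metric `g^{ab}`. -/
  ginv : Fin 4 → Fin 4 → A
  /-- The velocity `u^a`. -/
  u : Fin 4 → A
  d_comm : ∀ b c x, d b (d c x) = d c (d b x)
  g_symm : ∀ a b, g a b = g b a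
  ginv_symm : ∀ a b, ginv a b = ginv b a
  ginv_mul : ∀ a c, ∑ b, ginv a b * g b c = if a = c then 1 else 0
  unit : ∑ a, ∑ b, g a b * u a * u b = -1

theorem sum_rotate {A : Type*} [AddCommMonoid A] (f : Fin 4 → Fin 4 → Fin 4 → Fin 4 → A) :
    ∑ o, ∑ p, ∑ q, ∑ r, f o p q r = ∑ q, ∑ r, ∑ o, ∑ p, f o p q r := by
  have h := Finset.sum_comm (s := (Finset.univ : Finset (Fin 4 × Fin 4)))
    (t := (Finset.univ : Finset (Fin 4 × Fin 4))) (f := fun x y => f x.1 x.2 y.1 y.2)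
  simpa only [Fintype.sum_prod_type] using h

namespace Spacetime

variable {A : Type*} [CommRing A] [Algebra ℝ A] (G : Spacetime A)

/-! ### Tensor calculus over a differential ring -/

/-- Christoffel symbols `Γ^a_{bc}`. -/
def chr (a b c : Fin 4) : A :=
  algebraMap ℝ A (1 / 2) * ∑ e, G.ginv a e *
    (G.d b (G.g e c) + G.d c (G.g e b) - G.d e (G.g b c))

/-- The curvature `R^a_{bcd}`. -/
def riemUp (a b c d : Fin 4) : A :=
  G.d c (G.chr a b d) - G.d d (G.chr a b c) + ∑ e, G.chr e b d * G.chr a c e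
    - ∑ e, G.chr e b c * G.chr a d e

/-- The curvature `R_{abcd}`. -/
def riem (a b c d : Fin 4) : A := ∑ e, G.g a e * G.riemUp e b c d

/-- The covariant derivative `∇_c V_a`. -/
def nabla1 (V : Fin 4 → A) (c a : Fin 4) : A := G.d c (V a) - ∑ e, G.chr e c a * V e

/-- The covariant derivative `∇_c S_{ab}`. -/
def nabla2 (S : Fin 4 → Fin 4 → A) (c a b : Fin 4) : A :=
  G.d c (S a b) - ∑ e, G.chr e c a * S e b - ∑ e, G.chr e c b * S a e

/-- The covariant derivative `∇_d S_{cab}`. -/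
def nabla3 (S : Fin 4 → Fin 4 → Fin 4 → A) (d c a b : Fin 4) : A :=
  G.d d (S c a b) - ∑ e, G.chr e d c * S e a b - ∑ e, G.chr e d a * S c e b
    - ∑ e, G.chr e d b * S c a e

/-- The covariant derivative `∇_e S_{abcd}`. -/
def nabla4 (S : Fin 4 → Fin 4 → Fin 4 → Fin 4 → A) (e a b c d : Fin 4) : A :=
  G.d e (S a b c d) - ∑ f, G.chr f e a * S f b c d - ∑ f, G.chr f e b * S a f c d
    - ∑ f, G.chr f e c * S a b f d - ∑ f, G.chr f e d * S a b c f

/-- The trace `g^{ab} S_{ab}`. -/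
def tr (S : Fin 4 → Fin 4 → A) : A := ∑ a, ∑ b, G.ginv a b * S a b

/-- The contraction `u^a V_a`. -/
def cu (V : Fin 4 → A) : A := ∑ a, G.u a * V a

/-- The covector `u_a`. -/
def w (a : Fin 4) : A := ∑ b, G.g a b * G.u b

theorem mul_ginv (a c : Fin 4) : ∑ b, G.g a b * G.ginv b c = if a = c then 1 else 0 := by
  have h := G.ginv_mul c a
  simp only [G.ginv_symm c, G.g_symm _ a] at h
  simp only [mul_comm (G.g a _), h, eq_comm]

theorem ginv_mul_apply (V : Fin 4 → A) (a : Fin 4) :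
    ∑ b, G.ginv a b * ∑ c, G.g b c * V c = V a := by
  simp_rw [Finset.mul_sum, ← mul_assoc]
  rw [Finset.sum_comm]
  simp_rw [← Finset.sum_mul, G.ginv_mul]
  simp

theorem mul_ginv_apply (V : Fin 4 → A) (a : Fin 4) :
    ∑ b, G.g a b * ∑ c, G.ginv b c * V c = V a := by
  simp_rw [Finset.mul_sum, ← mul_assoc]
  rw [Finset.sum_comm]
  simp_rw [← Finset.sum_mul, G.mul_ginv]
  simp

theorem ginv_w (a : Fin 4) : ∑ b, G.ginv a b * G.w b = G.u a := G.ginv_mul_apply G.u a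

theorem cu_w : G.cu G.w = -1 := by
  rw [← G.unit]
  simp only [cu, w, Finset.mul_sum]
  exact Finset.sum_congr rfl fun a _ => Finset.sum_congr rfl fun b _ => by ring

theorem cu_g (b : Fin 4) : G.cu (fun a => G.g a b) = G.w b := by
  simp only [cu, w, G.g_symm b]
  exact Finset.sum_congr rfl fun a _ => by ring

theorem tr_add (S T : Fin 4 → Fin 4 → A) : G.tr (fun a b => S a b + T a b) = G.tr S + G.tr T := by
  simp only [tr, mul_add, Finset.sum_add_distrib]

theorem tr_sub (S T : Fin 4 → Fin 4 → A) : G.tr (fun a b => S a b - T a b) = G.tr S - G.tr T := by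
  simp only [tr, mul_sub, Finset.sum_sub_distrib]

theorem tr_smul (x : A) (S : Fin 4 → Fin 4 → A) :
    G.tr (fun a b => x * S a b) = x * G.tr S := by
  simp only [tr, Finset.mul_sum]
  exact Finset.sum_congr rfl fun a _ => Finset.sum_congr rfl fun b _ => by ring

theorem tr_smul' (x : A) (S : Fin 4 → Fin 4 → A) :
    G.tr (fun a b => S a b * x) = G.tr S * x := by
  simp only [mul_comm _ x, tr_smul]

theorem tr_swap (S : Fin 4 → Fin 4 → A) : G.tr (fun a b => S b a) = G.tr S := by
  simp only [tr]
  rw [Finset.sum_comm]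
  simp only [G.ginv_symm]

theorem tr_w_left (V : Fin 4 → A) : G.tr (fun a b => G.w a * V b) = G.cu V := by
  simp only [tr, cu]
  rw [Finset.sum_comm]
  refine Finset.sum_congr rfl fun b _ => ?_
  rw [← G.ginv_w b, Finset.sum_mul]
  exact Finset.sum_congr rfl fun a _ => by rw [G.ginv_symm]; ring

theorem tr_w_right (V : Fin 4 → A) : G.tr (fun a b => V a * G.w b) = G.cu V := by
  rw [← G.tr_swap, ← G.tr_w_left]
  simp only [mul_comm]

theorem tr_g : G.tr G.g = 4 := by
  simp only [tr]
  have : ∀ a, ∑ b, G.ginv a b * G.g a b = 1 := fun a => by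
    simpa [G.g_symm a] using G.ginv_mul a a
  simp only [this]
  simp

/-- Contracting a slot with the metric renames it: `g^{ab} g_{ac} V_b = V_c`. -/
theorem tr_g_left (V : Fin 4 → A) (c : Fin 4) : G.tr (fun a b => G.g a c * V b) = V c := by
  conv_rhs => rw [← G.mul_ginv_apply V c]
  simp only [tr, Finset.mul_sum, G.g_symm c]
  exact Finset.sum_congr rfl fun a _ => Finset.sum_congr rfl fun b _ => by ring

theorem tr_g_left' (V : Fin 4 → A) (c : Fin 4) : G.tr (fun a b => G.g c a * V b) = V c := by
  simp only [G.g_symm c, tr_g_left]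

theorem tr_g_right (V : Fin 4 → A) (c : Fin 4) : G.tr (fun a b => G.g b c * V a) = V c := by
  rw [← G.tr_g_left V c, ← G.tr_swap]

theorem tr_g_right' (V : Fin 4 → A) (c : Fin 4) : G.tr (fun a b => G.g c b * V a) = V c := by
  simp only [G.g_symm c, tr_g_right]

/-! ### The Levi-Civita connection -/

theorem chr_symm (a b c : Fin 4) : G.chr a b c = G.chr a c b := by
  simp only [chr, G.g_symm b c]
  congr 1
  exact Finset.sum_congr rfl fun e _ => by ring

theorem two_half : (2 : A) * algebraMap ℝ A (1 / 2) = 1 := by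
  rw [← map_ofNat (algebraMap ℝ A) 2, ← map_mul]; norm_num

theorem g_chr (a b c : Fin 4) : 2 * ∑ e, G.g a e * G.chr e b c
    = G.d b (G.g a c) + G.d c (G.g a b) - G.d a (G.g b c) := by
  rw [← G.mul_ginv_apply (fun a => G.d b (G.g a c) + G.d c (G.g a b) - G.d a (G.g b c)) a,
    Finset.mul_sum]
  refine Finset.sum_congr rfl fun e _ => ?_
  rw [chr]
  linear_combination (G.g a e * ∑ f, G.ginv e f *
    (G.d b (G.g f c) + G.d c (G.g f b) - G.d f (G.g b c))) * (two_half (A := A))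

theorem cancel_two {x y : A} (h : 2 * x = 2 * y) : x = y := by
  linear_combination algebraMap ℝ A (1 / 2) * h - (x - y) * two_half (A := A)

/-- The metric is covariantly constant. -/
theorem nabla_g (c a b : Fin 4) : G.nabla2 G.g c a b = 0 := by
  have h1 := G.g_chr b c a
  have h2 := G.g_chr a c b
  apply cancel_two
  have e1 : ∑ e, G.chr e c a * G.g e b = ∑ e, G.g b e * G.chr e c a :=
    Finset.sum_congr rfl fun e _ => by rw [G.g_symm e b]; ring
  have e2 : ∑ e, G.chr e c b * G.g a e = ∑ e, G.g a e * G.chr e c b :=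
    Finset.sum_congr rfl fun e _ => by ring
  rw [nabla2, e1, e2]
  rw [G.g_symm b a, G.g_symm b c] at h1
  rw [G.g_symm a c] at h2
  rw [G.g_symm c a, G.g_symm c b] at *
  linear_combination -h1 - h2

theorem d_g (c a b : Fin 4) : G.d c (G.g a b)
    = ∑ e, G.chr e c a * G.g e b + ∑ e, G.chr e c b * G.g a e := by
  have := G.nabla_g c a b
  rw [nabla2] at this
  linear_combination this

/-- The inverse metric is covariantly constant. -/
theorem d_ginv (c a b : Fin 4) : G.d c (G.ginv a b)
    = -∑ e, G.chr a c e * G.ginv e b - ∑ e, G.chr b c e * G.ginv a e := by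
  have key : ∀ b, ∑ f, (G.d c (G.ginv a f) + ∑ e, G.chr a c e * G.ginv e f
      + ∑ e, G.chr f c e * G.ginv a e) * G.g f b = 0 := by
    intro b
    have h0 : G.d c (∑ f, G.ginv a f * G.g f b) = 0 := by
      rw [G.ginv_mul]; split_ifs <;> simp
    simp only [map_sum, Derivation.leibniz, smul_eq_mul, d_g, Finset.sum_add_distrib] at h0
    simp only [add_mul, Finset.sum_add_distrib, mul_add, Finset.sum_mul, Finset.mul_sum] at h0 ⊢
    have h1 : ∑ f, ∑ e, G.chr a c e * G.ginv e f * G.g f b = G.chr a c b := by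
      rw [Finset.sum_comm]
      simp only [mul_assoc, ← Finset.mul_sum, G.ginv_mul]
      simp
    have h2 : ∑ f, ∑ e, G.ginv a f * (G.chr e c b * G.g f e) = G.chr a c b := by
      rw [Finset.sum_comm]
      have : ∀ e, ∑ f, G.ginv a f * (G.chr e c b * G.g f e)
          = G.chr e c b * ∑ f, G.ginv a f * G.g f e := fun e => by
        rw [Finset.mul_sum]; exact Finset.sum_congr rfl fun f _ => by ring
      simp only [this, G.ginv_mul]
      simp
    have h3 : ∑ f, ∑ e, G.chr f c e * G.ginv a e * G.g f b
        = ∑ f, ∑ e, G.ginv a f * (G.chr e c f * G.g e b) := by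
      rw [Finset.sum_comm]
      exact Finset.sum_congr rfl fun f _ => Finset.sum_congr rfl fun e _ => by ring
    have h4 : ∑ f, G.d c (G.ginv a f) * G.g f b = ∑ f, G.g f b * G.d c (G.ginv a f) :=
      Finset.sum_congr rfl fun e _ => by ring
    rw [h1, h3, h4]
    rw [h2] at h0
    linear_combination h0
  have h := G.ginv_mul_apply (fun f => G.d c (G.ginv a f) + ∑ e, G.chr a c e * G.ginv e f
      + ∑ e, G.chr f c e * G.ginv a e) b
  have h' : ∀ b, ∑ f, G.g b f * (G.d c (G.ginv a f) + ∑ e, G.chr a c e * G.ginv e f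
      + ∑ e, G.chr f c e * G.ginv a e) = 0 := fun b => by
    rw [← key b]; exact Finset.sum_congr rfl fun f _ => by rw [G.g_symm f b]; ring
  simp only [h', mul_zero, Finset.sum_const_zero] at h
  linear_combination -h

/-- The covariant derivative commutes with the metric trace. -/
theorem d_tr (c : Fin 4) (S : Fin 4 → Fin 4 → A) :
    G.d c (G.tr S) = G.tr (fun a b => G.nabla2 S c a b) := by
  simp only [tr, nabla2, Fin.sum_univ_four, map_add, Derivation.leibniz, smul_eq_mul, d_ginv]
  ring

theorem nabla1_tr (X : Fin 4 → Fin 4 → Fin 4 → A) (a b : Fin 4) :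
    G.nabla1 (fun b => G.tr fun p q => X p q b) a b = G.tr (fun p q => G.nabla3 X a p q b) := by
  have h := G.d_tr a (fun p q => X p q b)
  simp only [nabla1, h]
  have : ∀ e, G.chr e a b * G.tr (fun p q => X p q e)
      = G.tr (fun p q => G.chr e a b * X p q e) := fun e => by rw [tr_smul]
  simp only [this]
  have h2 : G.tr (fun p q => ∑ e, G.chr e a b * X p q e)
      = ∑ e, G.tr (fun p q => G.chr e a b * X p q e) := by
    simp only [Fin.sum_univ_four, tr_add]
  rw [← h2, ← tr_sub]
  congr 1

theorem cu_eq_tr (V : Fin 4 → A) : G.cu V = G.tr (fun a b => G.w a * V b) :=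
  (G.tr_w_left V).symm

theorem nabla2_mul (V W : Fin 4 → A) (c a b : Fin 4) :
    G.nabla2 (fun a b => V a * W b) c a b = G.nabla1 V c a * W b + V a * G.nabla1 W c b := by
  simp only [nabla2, nabla1, Derivation.leibniz, smul_eq_mul, Fin.sum_univ_four]
  ring

theorem nabla2_smul (f : A) (S : Fin 4 → Fin 4 → A) (c a b : Fin 4) :
    G.nabla2 (fun a b => f * S a b) c a b = G.d c f * S a b + f * G.nabla2 S c a b := by
  simp only [nabla2, Derivation.leibniz, smul_eq_mul, Fin.sum_univ_four]
  ring

theorem nabla2_add (S T : Fin 4 → Fin 4 → A) (c a b : Fin 4) :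
    G.nabla2 (fun a b => S a b + T a b) c a b = G.nabla2 S c a b + G.nabla2 T c a b := by
  simp only [nabla2, map_add, Fin.sum_univ_four]
  ring

theorem nabla2_swap (S : Fin 4 → Fin 4 → A) (c a b : Fin 4) :
    G.nabla2 (fun a b => S b a) c a b = G.nabla2 S c b a := by
  simp only [nabla2]
  ring

theorem nabla3_mul (V : Fin 4 → A) (S : Fin 4 → Fin 4 → A) (d c a b : Fin 4) :
    G.nabla3 (fun c a b => V c * S a b) d c a b
      = G.nabla1 V d c * S a b + V c * G.nabla2 S d a b := by
  simp only [nabla3, nabla2, nabla1, Derivation.leibniz, smul_eq_mul, Fin.sum_univ_four]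
  ring

theorem nabla3_smul (f : A) (S : Fin 4 → Fin 4 → Fin 4 → A) (d c a b : Fin 4) :
    G.nabla3 (fun c a b => f * S c a b) d c a b = G.d d f * S c a b + f * G.nabla3 S d c a b := by
  simp only [nabla3, Derivation.leibniz, smul_eq_mul, Fin.sum_univ_four]
  ring

theorem nabla3_add (S T : Fin 4 → Fin 4 → Fin 4 → A) (d c a b : Fin 4) :
    G.nabla3 (fun c a b => S c a b + T c a b) d c a b
      = G.nabla3 S d c a b + G.nabla3 T d c a b := by
  simp only [nabla3, map_add, Fin.sum_univ_four]
  ring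

theorem nabla3_swap12 (S : Fin 4 → Fin 4 → Fin 4 → A) (d c a b : Fin 4) :
    G.nabla3 (fun c a b => S a c b) d c a b = G.nabla3 S d a c b := by
  simp only [nabla3]
  ring

theorem nabla3_swap23 (S : Fin 4 → Fin 4 → Fin 4 → A) (d c a b : Fin 4) :
    G.nabla3 (fun c a b => S c b a) d c a b = G.nabla3 S d c b a := by
  simp only [nabla3]
  ring

/-- `∇_c u^a`, expressed by raising an index of `∇_c u_a`. -/
theorem d_u (c a : Fin 4) :
    G.d c (G.u a) = ∑ e, G.ginv a e * G.nabla1 G.w c e - ∑ e, G.chr a c e * G.u e := by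
  have h : G.d c (G.u a) = G.d c (∑ e, G.ginv a e * G.w e) := by rw [G.ginv_w]
  rw [h]
  have h2 : ∀ e, G.u e = ∑ f, G.ginv e f * G.w f := fun e => (G.ginv_w e).symm
  simp only [h2, nabla1, Fin.sum_univ_four, map_add, Derivation.leibniz, smul_eq_mul, d_ginv]
  rw [G.ginv_symm 1 0, G.ginv_symm 2 0, G.ginv_symm 3 0, G.ginv_symm 2 1, G.ginv_symm 3 1,
    G.ginv_symm 3 2]
  ring

/-- The Leibniz rule for the contraction with `u^a`, in which `∇_c u^a` appears as a metric
contraction with `∇_c u_a`. -/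
theorem d_cu (c : Fin 4) (V : Fin 4 → A) :
    G.d c (G.cu V) = G.cu (fun a => G.nabla1 V c a)
      + G.tr (fun a b => G.nabla1 G.w c a * V b) := by
  rw [cu_eq_tr, cu_eq_tr, d_tr]
  simp only [nabla2_mul, tr_add]
  ring

theorem nabla1_cu (c b : Fin 4) (S : Fin 4 → Fin 4 → A) :
    G.nabla1 (fun b => G.cu fun a => S a b) c b = G.cu (fun a => G.nabla2 S c a b)
      + G.tr (fun p q => G.nabla1 G.w c p * S q b) := by
  simp only [cu_eq_tr]
  have := G.nabla1_tr (fun p q b => G.w p * S q b) c b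
  simp only [this, nabla3_mul, tr_add]
  ring

theorem nabla2_cu (c a b : Fin 4) (S : Fin 4 → Fin 4 → Fin 4 → A) :
    G.nabla2 (fun a b => G.cu fun e => S e a b) c a b = G.cu (fun e => G.nabla3 S c e a b)
      + G.tr (fun p q => G.nabla1 G.w c p * S q a b) := by
  simp only [cu, tr, nabla2, nabla3, Fin.sum_univ_four, map_add, Derivation.leibniz, smul_eq_mul,
    d_u, G.ginv_symm 1 0, G.ginv_symm 2 0, G.ginv_symm 3 0, G.ginv_symm 2 1, G.ginv_symm 3 1,
    G.ginv_symm 3 2]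
  ring

/-- The Ricci identity for covectors. -/
theorem ricci_identity1 (V : Fin 4 → A) (d c a : Fin 4) :
    G.nabla2 (G.nabla1 V) d c a - G.nabla2 (G.nabla1 V) c d a
      = -∑ e, G.riemUp e a d c * V e := by
  simp only [nabla2, nabla1, riemUp, Fin.sum_univ_four, map_sub, map_add, Derivation.leibniz,
    smul_eq_mul, G.d_comm d c, G.chr_symm _ d c, G.chr_symm _ a d, G.chr_symm _ a c]
  ring

/-- The Ricci identity for tensors of rank two. -/
theorem ricci_identity2 (S : Fin 4 → Fin 4 → A) (d c a b : Fin 4) :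
    G.nabla3 (G.nabla2 S) d c a b - G.nabla3 (G.nabla2 S) c d a b
      = -∑ e, G.riemUp e a d c * S e b - ∑ e, G.riemUp e b d c * S a e := by
  simp only [nabla3, nabla2, riemUp, Fin.sum_univ_four, map_sub, map_add, Derivation.leibniz,
    smul_eq_mul, G.d_comm d c, G.chr_symm _ d c, G.chr_symm _ a d, G.chr_symm _ a c,
    G.chr_symm _ b d, G.chr_symm _ b c]
  ring

/-- The first Bianchi identity. -/
theorem bianchi1 (a b c d : Fin 4) : G.riem a b c d + G.riem a c d b + G.riem a d b c = 0 := by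
  simp only [riem, riemUp, Fin.sum_univ_four, G.chr_symm _ c b, G.chr_symm _ d b, G.chr_symm _ d c]
  ring

/-- The covariant derivative `∇_e R^a_{bcd}`. -/
def nablaRiemUp (e a b c d : Fin 4) : A :=
  G.d e (G.riemUp a b c d) + ∑ f, G.chr a e f * G.riemUp f b c d
    - ∑ f, G.chr f e b * G.riemUp a f c d - ∑ f, G.chr f e c * G.riemUp a b f d
    - ∑ f, G.chr f e d * G.riemUp a b c f

theorem riemUp_antisymm (a b c d : Fin 4) : G.riemUp a b c d = -G.riemUp a b d c := by
  simp only [riemUp]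
  ring

theorem bianchi2_up (e a b c d : Fin 4) :
    G.nablaRiemUp e a b c d + G.nablaRiemUp c a b d e + G.nablaRiemUp d a b e c = 0 := by
  have h : ∀ e c d, G.nablaRiemUp e a b c d
      = G.d e (G.riemUp a b c d) + ∑ f, G.chr a e f * G.riemUp f b c d
        - ∑ f, G.chr f b e * G.riemUp a f c d
        + (∑ f, G.chr f e c * G.riemUp a b d f - ∑ f, G.chr f d e * G.riemUp a b c f) := by
    intro e c d
    have h1 : ∑ f, G.chr f e c * G.riemUp a b f d = -∑ f, G.chr f e c * G.riemUp a b d f := by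
      rw [← Finset.sum_neg_distrib]
      exact Finset.sum_congr rfl fun f _ => by rw [G.riemUp_antisymm a b f d]; ring
    simp only [nablaRiemUp, h1, G.chr_symm _ d e, G.chr_symm _ b e]
    ring
  -- With the derivative index split off as above, this is the Bianchi identity of a matrix-valued
  -- connection; the remaining terms cancel cyclically as the torsion vanishes.
  have h2 : (G.d e (G.riemUp a b c d) + ∑ f, G.chr a e f * G.riemUp f b c d
        - ∑ f, G.chr f b e * G.riemUp a f c d)
      + (G.d c (G.riemUp a b d e) + ∑ f, G.chr a c f * G.riemUp f b d e
        - ∑ f, G.chr f b c * G.riemUp a f d e)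
      + (G.d d (G.riemUp a b e c) + ∑ f, G.chr a d f * G.riemUp f b e c
        - ∑ f, G.chr f b d * G.riemUp a f e c) = 0 := by
    simp only [riemUp, Fin.sum_univ_four, map_sub, map_add, Derivation.leibniz, smul_eq_mul,
      G.d_comm c e, G.d_comm d e, G.d_comm d c, G.chr_symm _ e 0, G.chr_symm _ e 1,
      G.chr_symm _ e 2, G.chr_symm _ e 3, G.chr_symm _ c 0, G.chr_symm _ c 1, G.chr_symm _ c 2,
      G.chr_symm _ c 3, G.chr_symm _ d 0, G.chr_symm _ d 1, G.chr_symm _ d 2, G.chr_symm _ d 3]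
    ring
  rw [h, h, h]
  linear_combination h2

theorem nabla4_riem (e a b c d : Fin 4) :
    G.nabla4 G.riem e a b c d = ∑ f, G.g a f * G.nablaRiemUp e f b c d := by
  simp only [nabla4, nablaRiemUp, riem, Fin.sum_univ_four, map_add, Derivation.leibniz,
    smul_eq_mul, d_g]
  rw [G.g_symm 1 0, G.g_symm 2 0, G.g_symm 3 0, G.g_symm 2 1, G.g_symm 3 1, G.g_symm 3 2]
  ring

/-- The second Bianchi identity. -/
theorem bianchi2 (e a b c d : Fin 4) :
    G.nabla4 G.riem e a b c d + G.nabla4 G.riem c a b d e + G.nabla4 G.riem d a b e c = 0 := by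
  rw [nabla4_riem, nabla4_riem, nabla4_riem, ← Finset.sum_add_distrib, ← Finset.sum_add_distrib]
  refine Finset.sum_eq_zero fun f _ => ?_
  rw [← mul_add, ← mul_add, bianchi2_up, mul_zero]

theorem ginv_riem (a b c d : Fin 4) : ∑ e, G.ginv a e * G.riem e b c d = G.riemUp a b c d :=
  G.ginv_mul_apply (fun e => G.riemUp e b c d) a

/-! ### The 1+3 splitting -/

/-- The projector `h_{ab}`. -/
def hLow (a b : Fin 4) : A := G.g a b + G.w a * G.w b

/-- The projector `h^a_b`, the upper index first. -/
def hMix (a b : Fin 4) : A := (if a = b then 1 else 0) + G.u a * G.w b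

/-- The projector `h^{ab}`. -/
def hUp (a b : Fin 4) : A := G.ginv a b + G.u a * G.u b

/-- The projection of both slots of `S_{ab}`. -/
def proj2 (S : Fin 4 → Fin 4 → A) (a b : Fin 4) : A :=
  ∑ c, ∑ d, G.hMix c a * G.hMix d b * S c d

/-- The spatial trace `h^{ab} S_{ab}`. -/
def trh (S : Fin 4 → Fin 4 → A) : A := ∑ a, ∑ b, G.hUp a b * S a b

/-- The time derivative `u^e ∇_e S_{ab}`. -/
def dot2 (S : Fin 4 → Fin 4 → A) (a b : Fin 4) : A := ∑ e, G.u e * G.nabla2 S e a b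

/-- The projected gradient of a scalar. -/
def D0 (f : A) (a : Fin 4) : A := ∑ b, G.hMix b a * G.d b f

/-- The projected derivative `D_c V_a`. -/
def D1 (V : Fin 4 → A) (c a : Fin 4) : A :=
  ∑ p, ∑ q, G.hMix p c * G.hMix q a * G.nabla1 V p q

/-- The projected derivative `D_c S_{ab}`. -/
def D2 (S : Fin 4 → Fin 4 → A) (c a b : Fin 4) : A :=
  ∑ p, ∑ q, ∑ r, G.hMix p c * G.hMix q a * G.hMix r b * G.nabla2 S p q r

/-- The projected derivative `D_d S_{cab}`. -/
def D3 (S : Fin 4 → Fin 4 → Fin 4 → A) (d c a b : Fin 4) : A :=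
  ∑ o, ∑ p, ∑ q, ∑ r, G.hMix o d * G.hMix p c * G.hMix q a * G.hMix r b * G.nabla3 S o p q r

/-- The spatial Laplacian. -/
def lap2 (S : Fin 4 → Fin 4 → A) (a b : Fin 4) : A :=
  ∑ c, ∑ d, G.hUp c d * G.D3 (G.D2 S) c d a b

/-- The spatial divergence `D^b S_{ab}`. -/
def div2 (S : Fin 4 → Fin 4 → A) (a : Fin 4) : A :=
  ∑ b, ∑ c, G.hUp b c * G.D2 S c a b

/-- The projected symmetric trace-free part. -/
def pstf (S : Fin 4 → Fin 4 → A) (a b : Fin 4) : A :=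
  (∑ c, ∑ d, G.hMix c a * G.hMix d b * ((S c d + S d c) * algebraMap ℝ A (1 / 2)))
    - algebraMap ℝ A (1 / 3) * G.hLow a b * ∑ c, ∑ d, G.hUp c d * S c d

/-- The acceleration `u^e ∇_e u_a`. -/
def acceleration (a : Fin 4) : A := ∑ e, G.u e * G.nabla1 G.w e a

/-- The expansion `Θ`. -/
def expansion : A := ∑ a, ∑ b, G.hUp a b * G.D1 G.w a b

/-- The shear `σ_{ab}`. -/
def shear : Fin 4 → Fin 4 → A := G.pstf (G.D1 G.w)

/-- The Ricci tensor. -/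
def ricci (a b : Fin 4) : A := ∑ c, ∑ d, G.ginv c d * G.riem c a d b

/-- The Ricci scalar. -/
def scalarCurv : A := ∑ a, ∑ b, G.ginv a b * G.ricci a b

/-- The Einstein tensor. -/
def einstein (a b : Fin 4) : A :=
  G.ricci a b - algebraMap ℝ A (1 / 2) * G.scalarCurv * G.g a b

/-- The Weyl tensor. -/
def weyl (a b c d : Fin 4) : A :=
  G.riem a b c d
    - algebraMap ℝ A (1 / 2) * (G.g a c * G.ricci b d - G.g a d * G.ricci b c
        - G.g b c * G.ricci a d + G.g b d * G.ricci a c)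
    + algebraMap ℝ A (1 / 6) * G.scalarCurv * (G.g a c * G.g b d - G.g a d * G.g b c)

/-- The energy density of the matter determined by the Einstein equations. -/
def density : A := ∑ a, ∑ b, G.einstein a b * G.u a * G.u b

/-- The isotropic pressure of the matter determined by the Einstein equations. -/
def pressure : A := algebraMap ℝ A (1 / 3) * ∑ a, ∑ b, G.hUp a b * G.einstein a b

/-- The heat flux of the matter determined by the Einstein equations. -/
def heatFlux (a : Fin 4) : A := -∑ c, ∑ d, G.hMix c a * G.einstein c d * G.u d

theorem cu_add (V W : Fin 4 → A) : G.cu (fun a => V a + W a) = G.cu V + G.cu W := by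
  simp only [cu, mul_add, Finset.sum_add_distrib]

theorem cu_sub (V W : Fin 4 → A) : G.cu (fun a => V a - W a) = G.cu V - G.cu W := by
  simp only [cu, mul_sub, Finset.sum_sub_distrib]

theorem cu_neg (V : Fin 4 → A) : G.cu (fun a => -V a) = -G.cu V := by
  simp only [cu, mul_neg, Finset.sum_neg_distrib]

theorem cu_smul (x : A) (V : Fin 4 → A) : G.cu (fun a => x * V a) = x * G.cu V := by
  simp only [cu, Finset.mul_sum]
  exact Finset.sum_congr rfl fun a _ => by ring

theorem cu_smul' (x : A) (V : Fin 4 → A) : G.cu (fun a => V a * x) = G.cu V * x := by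
  simp only [mul_comm _ x, cu_smul]

theorem cu_zero : G.cu (fun _ => 0) = 0 := by simp [cu]

theorem cu_g' (b : Fin 4) : G.cu (fun a => G.g b a) = G.w b := by
  simp only [G.g_symm b, cu_g]

theorem cu_cu_comm (S : Fin 4 → Fin 4 → A) :
    G.cu (fun a => G.cu fun b => S a b) = G.cu (fun b => G.cu fun a => S a b) := by
  simp only [cu, Finset.mul_sum]
  rw [Finset.sum_comm]
  exact Finset.sum_congr rfl fun a _ => Finset.sum_congr rfl fun b _ => by ring

theorem sum_hMix (V : Fin 4 → A) (a : Fin 4) : ∑ b, G.hMix b a * V b = V a + G.cu V * G.w a := by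
  simp only [hMix, add_mul, Finset.sum_add_distrib, cu, Finset.sum_mul]
  congr 1
  · simp
  · exact Finset.sum_congr rfl fun b _ => by ring

theorem proj2_eq (S : Fin 4 → Fin 4 → A) (a b : Fin 4) :
    G.proj2 S a b = S a b + G.cu (fun d => S a d) * G.w b + G.cu (fun c => S c b) * G.w a
      + G.cu (fun c => G.cu fun d => S c d) * G.w b * G.w a := by
  simp only [proj2, mul_assoc, ← Finset.mul_sum, sum_hMix, cu_add, cu_smul']
  ring

theorem proj2_swap (S : Fin 4 → Fin 4 → A) (a b : Fin 4) :
    G.proj2 (fun c d => S d c) a b = G.proj2 S b a := by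
  rw [proj2, proj2, Finset.sum_comm]
  exact Finset.sum_congr rfl fun c _ => Finset.sum_congr rfl fun d _ => by ring

theorem trh_eq (S : Fin 4 → Fin 4 → A) :
    G.trh S = G.tr S + G.cu fun a => G.cu fun b => S a b := by
  simp only [trh, hUp, add_mul, Finset.sum_add_distrib, tr, cu, Finset.mul_sum, mul_assoc]

theorem three_third : (3 : A) * algebraMap ℝ A (1 / 3) = 1 := by
  rw [← map_ofNat (algebraMap ℝ A) 3, ← map_mul]; norm_num

theorem six_sixth : (6 : A) * algebraMap ℝ A (1 / 6) = 1 := by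
  rw [← map_ofNat (algebraMap ℝ A) 6, ← map_mul]; norm_num

theorem cancel_six {x y : A} (h : 6 * x = 6 * y) : x = y := by
  linear_combination algebraMap ℝ A (1 / 6) * h - (x - y) * six_sixth (A := A)

theorem pstf_eq (S : Fin 4 → Fin 4 → A) (a b : Fin 4) :
    G.pstf S a b = G.proj2 (fun c d => (S c d + S d c) * algebraMap ℝ A (1 / 2)) a b
      - algebraMap ℝ A (1 / 3) * G.hLow a b * G.trh S := rfl

theorem tr_proj2 (S : Fin 4 → Fin 4 → A) : G.tr (G.proj2 S) = G.trh S := by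
  have : G.tr (G.proj2 S) = G.tr (fun a b => G.proj2 S a b) := rfl
  rw [this]
  simp only [proj2_eq, tr_add, tr_w_right, mul_assoc, tr_smul, trh_eq]
  have h : G.tr (fun a b => G.cu (fun c => S c b) * G.w a) = G.cu fun b => G.cu fun c => S c b := by
    simp only [mul_comm _ (G.w _), tr_w_left]
  have h' : G.tr (fun a b => G.w b * G.w a) = -1 := by
    rw [← G.cu_w, ← G.tr_w_right G.w, ← G.tr_swap]
  rw [h, h', G.cu_cu_comm S]
  ring

theorem tr_hLow : G.tr (fun a b => G.hLow a b) = 3 := by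
  have h : G.tr (fun a b => G.g a b) = 4 := G.tr_g
  simp only [hLow, tr_add, tr_w_left, cu_w, h]
  norm_num

theorem cu_hLow (b : Fin 4) : G.cu (fun a => G.hLow a b) = 0 := by
  simp only [hLow, cu_add, cu_g, cu_smul', cu_w]
  ring

theorem hLow_symm (a b : Fin 4) : G.hLow a b = G.hLow b a := by
  rw [hLow, hLow, G.g_symm a b]
  ring

theorem cu_proj2 (S : Fin 4 → Fin 4 → A) (b : Fin 4) : G.cu (fun a => G.proj2 S a b) = 0 := by
  simp only [proj2_eq, cu_add, cu_smul', cu_smul, cu_w]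
  ring

theorem trh_symm_part (S : Fin 4 → Fin 4 → A) :
    G.trh (fun c d => (S c d + S d c) * algebraMap ℝ A (1 / 2)) = G.trh S := by
  simp only [trh_eq, tr_smul', tr_add, cu_smul', cu_add]
  have h : G.cu (fun a => G.cu fun b => S b a) = G.cu (fun a => G.cu fun b => S a b) :=
    G.cu_cu_comm fun a b => S b a
  rw [G.tr_swap S, h]
  linear_combination (G.tr S + G.cu fun a => G.cu fun b => S a b) * two_half (A := A)

theorem pstf_symm (S : Fin 4 → Fin 4 → A) (a b : Fin 4) : G.pstf S a b = G.pstf S b a := by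
  have h : (fun c d => (S c d + S d c) * algebraMap ℝ A (1 / 2))
      = fun c d => (S d c + S c d) * algebraMap ℝ A (1 / 2) := by
    funext c d; rw [add_comm]
  rw [pstf_eq, pstf_eq, G.hLow_symm a b, ← proj2_swap, h]

theorem cu_pstf (S : Fin 4 → Fin 4 → A) (b : Fin 4) : G.cu (fun a => G.pstf S a b) = 0 := by
  simp only [pstf_eq, cu_sub, cu_proj2, cu_smul, cu_smul', cu_hLow]
  ring

theorem tr_pstf (S : Fin 4 → Fin 4 → A) : G.tr (fun a b => G.pstf S a b) = 0 := by
  simp only [pstf_eq, tr_sub, tr_smul, tr_smul', tr_hLow]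
  have := G.tr_proj2 (fun c d => (S c d + S d c) * algebraMap ℝ A (1 / 2))
  rw [trh_symm_part] at this
  rw [show G.tr (fun a b => G.proj2 (fun c d => (S c d + S d c) * algebraMap ℝ A (1 / 2)) a b)
    = G.trh S from this]
  linear_combination -G.trh S * three_third (A := A)

theorem proj2_of_spatial {S : Fin 4 → Fin 4 → A} (h1 : ∀ b, G.cu (fun a => S a b) = 0)
    (h2 : ∀ a, G.cu (fun b => S a b) = 0) (a b : Fin 4) : G.proj2 S a b = S a b := by
  simp only [proj2_eq, h1, h2, cu_zero]
  ring

theorem trh_of_spatial {S : Fin 4 → Fin 4 → A} (h2 : ∀ a, G.cu (fun b => S a b) = 0) :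
    G.trh S = G.tr S := by
  simp only [trh_eq, h2, cu_zero]
  ring

theorem pstf_of_spatial {S : Fin 4 → Fin 4 → A} (hs : ∀ a b, S a b = S b a)
    (h1 : ∀ b, G.cu (fun a => S a b) = 0) (a b : Fin 4) :
    G.pstf S a b = S a b - algebraMap ℝ A (1 / 3) * G.hLow a b * G.tr S := by
  have h2 : ∀ a, G.cu (fun b => S a b) = 0 := fun a => by simp only [hs a, h1]
  rw [pstf_eq, trh_of_spatial G h2, proj2_of_spatial]
  · rw [hs b a]
    linear_combination S a b * two_half (A := A)
  · intro b; simp only [cu_smul', cu_add, h1, h2]; ring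
  · intro b; simp only [cu_smul', cu_add, h1, h2]; ring

/-! ### The linearised equations for tensor modes -/

/-- A conformally flat perturbation restricted to tensor modes, in the linearised regime: `I` is
the ideal of first-order quantities, products of two of which are neglected. -/
structure IsTensorMode (I : Ideal A) : Prop where
  mul_eq_zero : ∀ x ∈ I, ∀ y ∈ I, x * y = 0
  d_mem : ∀ c, ∀ x ∈ I, G.d c x ∈ I
  shear_mem : ∀ a b, G.shear a b ∈ I
  weyl_eq : ∀ a b c d, G.weyl a b c d = 0
  acceleration_eq : ∀ a, G.acceleration a = 0
  vorticity_free : ∀ a b, G.D1 G.w a b = G.D1 G.w b a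
  heatFlux_eq : ∀ a, G.heatFlux a = 0
  grad_expansion : ∀ a, G.D0 G.expansion a = 0
  grad_density : ∀ a, G.D0 G.density a = 0
  grad_pressure : ∀ a, G.D0 G.pressure a = 0

/-- One third of the expansion, the Hubble rate `θ` of the congruence. -/
def hubble : A := algebraMap ℝ A (1 / 3) * G.expansion

/-- The time derivative `u^e ∂_e f` of a scalar. -/
def dot0 (f : A) : A := G.cu fun a => G.d a f

theorem three_hubble : 3 * G.hubble = G.expansion := by
  rw [hubble]
  linear_combination G.expansion * three_third (A := A)

theorem cu_nabla_w (c : Fin 4) : G.cu (fun a => G.nabla1 G.w c a) = 0 := by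
  have h := G.d_cu c G.w
  simp only [cu_w, tr_w_right, map_neg, Derivation.map_one_eq_zero] at h
  apply cancel_two
  linear_combination -h

theorem D1_eq (V : Fin 4 → A) : G.D1 V = G.proj2 (G.nabla1 V) := rfl

theorem D0_eq (f : A) (a : Fin 4) : G.D0 f a = G.d a f + G.dot0 f * G.w a := G.sum_hMix _ a

theorem dot2_eq (S : Fin 4 → Fin 4 → A) (a b : Fin 4) :
    G.dot2 S a b = G.cu (fun e => G.nabla2 S e a b) := rfl

theorem shear_symm (a b : Fin 4) : G.shear a b = G.shear b a := G.pstf_symm _ a b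

theorem cu_shear (b : Fin 4) : G.cu (fun a => G.shear a b) = 0 := G.cu_pstf _ b

theorem cu_shear' (a : Fin 4) : G.cu (fun b => G.shear a b) = 0 := by
  simp only [G.shear_symm a, cu_shear]

theorem tr_shear : G.tr (fun a b => G.shear a b) = 0 := G.tr_pstf _

theorem nabla2_hLow (c a b : Fin 4) : G.nabla2 G.hLow c a b
    = G.nabla1 G.w c a * G.w b + G.w a * G.nabla1 G.w c b := by
  have h : G.hLow = fun a b => G.g a b + G.w a * G.w b := rfl
  rw [h, nabla2_add, nabla2_mul]
  have := G.nabla_g c a b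
  linear_combination this

theorem nabla1_zero (c a : Fin 4) : G.nabla1 (fun _ => 0) c a = 0 := by simp [nabla1]

theorem tr_congr {S T : Fin 4 → Fin 4 → A} (h : ∀ a b, S a b = T a b) : G.tr S = G.tr T :=
  congrArg G.tr (funext fun a => funext fun b => h a b)

theorem cu_congr {S T : Fin 4 → A} (h : ∀ a, S a = T a) : G.cu S = G.cu T :=
  congrArg G.cu (funext h)

theorem trh_congr {S T : Fin 4 → Fin 4 → A} (h : ∀ a b, S a b = T a b) : G.trh S = G.trh T :=
  congrArg G.trh (funext fun a => funext fun b => h a b)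

theorem trh_add (S T : Fin 4 → Fin 4 → A) :
    G.trh (fun a b => S a b + T a b) = G.trh S + G.trh T := by
  simp only [trh, mul_add, Finset.sum_add_distrib]

theorem trh_sub (S T : Fin 4 → Fin 4 → A) :
    G.trh (fun a b => S a b - T a b) = G.trh S - G.trh T := by
  simp only [trh, mul_sub, Finset.sum_sub_distrib]

theorem trh_neg (S : Fin 4 → Fin 4 → A) : G.trh (fun a b => -S a b) = -G.trh S := by
  simp only [trh, mul_neg, Finset.sum_neg_distrib]

theorem trh_smul (x : A) (S : Fin 4 → Fin 4 → A) :
    G.trh (fun a b => x * S a b) = x * G.trh S := by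
  simp only [trh, Finset.mul_sum]
  exact Finset.sum_congr rfl fun a _ => Finset.sum_congr rfl fun b _ => by ring

theorem trh_smul' (x : A) (S : Fin 4 → Fin 4 → A) :
    G.trh (fun a b => S a b * x) = G.trh S * x := by
  simp only [mul_comm _ x, trh_smul]

theorem trh_w_left (V : Fin 4 → A) : G.trh (fun a b => G.w a * V b) = 0 := by
  simp only [trh_eq, tr_w_left, cu_smul, cu_smul', cu_w]
  ring

theorem trh_w_right (V : Fin 4 → A) : G.trh (fun a b => G.w b * V a) = 0 := by
  simp only [trh_eq, mul_comm (G.w _), tr_w_right, cu_smul, cu_smul', cu_w]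
  ring

theorem trh_g_left (V : Fin 4 → A) (c : Fin 4) :
    G.trh (fun a b => G.g c a * V b) = V c + G.w c * G.cu V := by
  simp only [trh_eq, tr_g_left', cu_smul, cu_smul', cu_g']

theorem trh_g_right (V : Fin 4 → A) (c : Fin 4) :
    G.trh (fun a b => G.g b c * V a) = V c + G.w c * G.cu V := by
  simp only [trh_eq, tr_g_right, cu_smul', cu_g, cu_smul]

theorem dot2_symm {S : Fin 4 → Fin 4 → A} (hs : ∀ a b, S a b = S b a) (a b : Fin 4) :
    G.dot2 S a b = G.dot2 S b a := by
  have h : S = fun a b => S b a := funext fun a => funext fun b => hs a b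
  simp only [dot2_eq]
  refine G.cu_congr fun e => ?_
  conv_lhs => rw [h, nabla2_swap]

theorem tr_dot2 {S : Fin 4 → Fin 4 → A} (ht : G.tr S = 0) :
    G.tr (fun a b => G.dot2 S a b) = 0 := by
  have h : ∀ e, G.tr (fun a b => G.nabla2 S e a b) = 0 := fun e => by
    rw [← G.d_tr, ht, map_zero]
  have h2 : G.tr (fun a b => G.dot2 S a b)
      = G.cu (fun e => G.tr fun a b => G.nabla2 S e a b) := by
    simp only [tr, dot2_eq, cu, Fin.sum_univ_four]
    ring
  rw [h2]
  simp only [h, cu_zero]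

namespace IsTensorMode

variable {G} {I : Ideal A} (M : G.IsTensorMode I)

include M

theorem tr_mul_eq_zero (V W : Fin 4 → A) (hV : ∀ a, V a ∈ I) (hW : ∀ a, W a ∈ I) :
    G.tr (fun a b => V a * W b) = 0 := by
  refine Finset.sum_eq_zero fun a _ => Finset.sum_eq_zero fun b _ => ?_
  simp only [M.mul_eq_zero _ (hV a) _ (hW b), mul_zero]

theorem cu_nabla_w_left (b : Fin 4) : G.cu (fun a => G.nabla1 G.w a b) = 0 :=
  M.acceleration_eq b

/-- The decomposition of the velocity gradient `∇_a u_b = θ h_{ab} + σ_{ab}` of a geodesic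
irrotational congruence. -/
theorem nabla_w (a b : Fin 4) : G.nabla1 G.w a b = G.hubble * G.hLow a b + G.shear a b := by
  have h : G.D1 G.w = G.nabla1 G.w := by
    funext a b
    rw [D1_eq]
    exact G.proj2_of_spatial M.cu_nabla_w_left G.cu_nabla_w a b
  have hs : ∀ a b, G.nabla1 G.w a b = G.nabla1 G.w b a := by
    rw [← h]; exact M.vorticity_free
  have ht : G.expansion = G.tr (G.nabla1 G.w) := by
    rw [← G.trh_of_spatial G.cu_nabla_w, ← h]; rfl
  rw [shear, h, G.pstf_of_spatial hs M.cu_nabla_w_left, hubble, ht]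
  ring

theorem nabla_w_symm (a b : Fin 4) : G.nabla1 G.w a b = G.nabla1 G.w b a := by
  rw [M.nabla_w, M.nabla_w, G.hLow_symm, G.shear_symm]

/-- Contracting a first-order covector with `∇_c u^a`: the shear drops out. -/
theorem tr_nabla_w {V : Fin 4 → A} (hV : ∀ a, V a ∈ I) (c : Fin 4) :
    G.tr (fun p q => G.nabla1 G.w c p * V q) = G.hubble * (V c + G.w c * G.cu V) := by
  have h := M.tr_mul_eq_zero _ V (fun p => M.shear_mem c p) hV
  simp only [M.nabla_w, hLow, add_mul, mul_assoc, tr_add, tr_smul, tr_g_left', tr_w_left, h]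
  ring

/-- For a spatial tensor of first order only `∇_c u^a` contributes to `u^a ∇_c S_{ab}`. -/
theorem cu_nabla2 {S : Fin 4 → Fin 4 → A} (hS : ∀ a b, S a b ∈ I)
    (h1 : ∀ b, G.cu (fun a => S a b) = 0) (c b : Fin 4) :
    G.cu (fun a => G.nabla2 S c a b) = -(G.hubble * S c b) := by
  have h := G.nabla1_cu c b S
  rw [M.tr_nabla_w (fun a => hS a b)] at h
  simp only [h1, nabla1_zero] at h
  linear_combination -h

theorem cu_nabla2' {S : Fin 4 → Fin 4 → A} (hS : ∀ a b, S a b ∈ I) (hs : ∀ a b, S a b = S b a)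
    (h1 : ∀ b, G.cu (fun a => S a b) = 0) (c a : Fin 4) :
    G.cu (fun b => G.nabla2 S c a b) = -(G.hubble * S a c) := by
  have h : S = fun a b => S b a := funext fun a => funext fun b => hs a b
  rw [hs a c, ← M.cu_nabla2 hS h1]
  refine G.cu_congr fun e => ?_
  conv_lhs => rw [h, nabla2_swap]

theorem nabla2_mem {S : Fin 4 → Fin 4 → A} (hS : ∀ a b, S a b ∈ I) (c a b : Fin 4) :
    G.nabla2 S c a b ∈ I :=
  I.sub_mem (I.sub_mem (M.d_mem _ _ (hS a b)) (I.sum_mem fun e _ => I.mul_mem_left _ (hS e b)))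
    (I.sum_mem fun e _ => I.mul_mem_left _ (hS a e))

theorem dot2_mem {S : Fin 4 → Fin 4 → A} (hS : ∀ a b, S a b ∈ I) (a b : Fin 4) :
    G.dot2 S a b ∈ I :=
  I.sum_mem fun e _ => I.mul_mem_left _ (M.nabla2_mem hS e a b)

theorem cu_dot2 {S : Fin 4 → Fin 4 → A} (hS : ∀ a b, S a b ∈ I)
    (h1 : ∀ b, G.cu (fun a => S a b) = 0) (b : Fin 4) : G.cu (fun a => G.dot2 S a b) = 0 := by
  simp only [dot2_eq]
  rw [G.cu_cu_comm]
  simp only [M.cu_nabla2 hS h1, cu_neg, cu_smul, h1]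
  ring

/-- The time derivative of a first-order spatial, symmetric and trace-free tensor has these
properties again, so that the angle brackets may be dropped. -/
theorem pstf_dot2 {S : Fin 4 → Fin 4 → A} (hS : ∀ a b, S a b ∈ I) (hs : ∀ a b, S a b = S b a)
    (h1 : ∀ b, G.cu (fun a => S a b) = 0) (ht : G.tr S = 0) (a b : Fin 4) :
    G.pstf (G.dot2 S) a b = G.dot2 S a b := by
  rw [G.pstf_of_spatial (G.dot2_symm hs) (M.cu_dot2 hS h1)]
  have : G.tr (G.dot2 S) = 0 := G.tr_dot2 ht
  rw [this]
  ring

theorem d_expansion (a : Fin 4) : G.d a G.expansion = -(G.dot0 G.expansion * G.w a) := by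
  have := M.grad_expansion a
  rw [D0_eq] at this
  linear_combination this

theorem d_density (a : Fin 4) : G.d a G.density = -(G.dot0 G.density * G.w a) := by
  have := M.grad_density a
  rw [D0_eq] at this
  linear_combination this

theorem d_pressure (a : Fin 4) : G.d a G.pressure = -(G.dot0 G.pressure * G.w a) := by
  have := M.grad_pressure a
  rw [D0_eq] at this
  linear_combination this

theorem d_hubble (a : Fin 4) : G.d a G.hubble = -(G.dot0 G.hubble * G.w a) := by
  have h : ∀ a, G.d a G.hubble = algebraMap ℝ A (1 / 3) * G.d a G.expansion := fun a => by
    simp [hubble]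
  simp only [dot0, h, cu_smul]
  rw [M.d_expansion, dot0]
  ring

end IsTensorMode

/-! ### The curvature of a conformally flat spacetime -/

/-- Twice the Schouten tensor, `R_{ab} - R g_{ab} / 6`. -/
def schouten (a b : Fin 4) : A :=
  G.ricci a b - algebraMap ℝ A (1 / 6) * G.scalarCurv * G.g a b

/-- The anisotropic stress `π_{ab} = T_{ab} - μ u_a u_b - p h_{ab}` when the heat flux vanishes. -/
def stress (a b : Fin 4) : A :=
  G.einstein a b - G.density * (G.w a * G.w b) - G.pressure * G.hLow a b

namespace IsTensorMode

variable {G} {I : Ideal A} (M : G.IsTensorMode I)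

include M

theorem two_mul_riem (a b c d : Fin 4) : 2 * G.riem a b c d = G.g a c * G.schouten b d
    - G.g a d * G.schouten b c - G.g b c * G.schouten a d + G.g b d * G.schouten a c := by
  have h := M.weyl_eq a b c d
  rw [weyl] at h
  simp only [schouten]
  linear_combination 2 * h + (G.g a c * G.ricci b d - G.g a d * G.ricci b c
        - G.g b c * G.ricci a d + G.g b d * G.ricci a c) * two_half (A := A)

/-- The symmetry of the Ricci tensor, here from the first Bianchi identity for the conformally flat
form of the curvature. -/
theorem schouten_symm (a b : Fin 4) : G.schouten a b = G.schouten b a := by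
  have h : ∀ e a c b, G.g e c * (G.schouten b a - G.schouten a b)
      + G.g e a * (G.schouten c b - G.schouten b c)
      + G.g e b * (G.schouten a c - G.schouten c a) = 0 := by
    intro e a c b
    have h0 := G.bianchi1 e b c a
    have h1 := M.two_mul_riem e b c a
    have h2 := M.two_mul_riem e c a b
    have h3 := M.two_mul_riem e a b c
    simp only [G.g_symm b a, G.g_symm c a, G.g_symm c b] at h1 h2 h3
    linear_combination 2 * h0 - h1 - h2 - h3
  have h2 : G.tr (fun e c => G.g e c * (G.schouten b a - G.schouten a b)
      + G.g e a * (G.schouten c b - G.schouten b c)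
      + G.g e b * (G.schouten a c - G.schouten c a)) = 0 := by
    simp only [h]; simp [tr]
  have hg : G.tr (fun a b => G.g a b) = 4 := G.tr_g
  simp only [tr_add, tr_smul', tr_g_left, hg] at h2
  apply cancel_two
  linear_combination -h2

theorem ricci_symm (a b : Fin 4) : G.ricci a b = G.ricci b a := by
  have h := M.schouten_symm a b
  rw [schouten, schouten, G.g_symm b a] at h
  linear_combination h

theorem einstein_symm (a b : Fin 4) : G.einstein a b = G.einstein b a := by
  rw [einstein, einstein, M.ricci_symm a b, G.g_symm a b]

omit M in
theorem density_eq : G.density = G.cu (fun a => G.cu fun b => G.einstein a b) := by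
  simp only [density, cu, Finset.mul_sum]
  exact Finset.sum_congr rfl fun a _ => Finset.sum_congr rfl fun b _ => by ring

omit M in
theorem heatFlux_expand (a : Fin 4) : G.heatFlux a
    = -(G.cu (fun d => G.einstein a d) + G.cu (fun c => G.cu fun d => G.einstein c d) * G.w a) := by
  rw [heatFlux, ← G.sum_hMix (fun c => G.cu fun d => G.einstein c d)]
  simp only [cu, Finset.mul_sum]
  congr 1
  exact Finset.sum_congr rfl fun a _ => Finset.sum_congr rfl fun b _ => by ring

theorem cu_einstein (a : Fin 4) : G.cu (fun b => G.einstein a b) = -(G.density * G.w a) := by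
  have h := M.heatFlux_eq a
  rw [heatFlux_expand, ← density_eq] at h
  linear_combination -h

omit M in
theorem three_pressure : 3 * G.pressure = G.tr G.einstein + G.density := by
  have : G.pressure = algebraMap ℝ A (1 / 3) * G.trh G.einstein := rfl
  rw [this, trh_eq, density_eq]
  linear_combination (G.tr G.einstein + G.cu fun a => G.cu fun b => G.einstein a b)
    * three_third (A := A)

omit M in
theorem tr_einstein : G.tr G.einstein = -G.scalarCurv := by
  have h : G.tr G.einstein = G.tr (fun a b => G.ricci a b
    - algebraMap ℝ A (1 / 2) * G.scalarCurv * G.g a b) := rfl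
  have hg : G.tr (fun a b => G.g a b) = 4 := G.tr_g
  have hr : G.tr (fun a b => G.ricci a b) = G.scalarCurv := rfl
  rw [h, tr_sub, tr_smul, hg, hr]
  linear_combination -2 * G.scalarCurv * two_half (A := A)

omit M in
theorem scalarCurv_eq : G.scalarCurv = G.density - 3 * G.pressure := by
  linear_combination three_pressure (G := G) + tr_einstein (G := G)

theorem stress_symm (a b : Fin 4) : G.stress a b = G.stress b a := by
  rw [stress, stress, M.einstein_symm, G.hLow_symm]
  ring

theorem cu_stress' (a : Fin 4) : G.cu (fun b => G.stress a b) = 0 := by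
  have h : G.cu (fun b => G.hLow a b) = 0 := by simp only [G.hLow_symm a, cu_hLow]
  simp only [stress, cu_sub, cu_smul, M.cu_einstein, h, cu_w]
  ring

theorem cu_stress (b : Fin 4) : G.cu (fun a => G.stress a b) = 0 := by
  simp only [M.stress_symm _ b, M.cu_stress']

omit M in
theorem tr_stress : G.tr (fun a b => G.stress a b) = 0 := by
  simp only [stress, tr_sub, tr_smul, tr_w_left, cu_w, tr_hLow]
  linear_combination -three_pressure (G := G)

omit M in
/-- The Schouten tensor in terms of the matter, by the Einstein equations. -/
theorem schouten_eq (a b : Fin 4) : 3 * G.schouten a b = 3 * G.stress a b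
    + 3 * ((G.density + G.pressure) * (G.w a * G.w b)) + G.density * G.g a b := by
  have h : G.ricci a b = G.einstein a b + algebraMap ℝ A (1 / 2) * G.scalarCurv * G.g a b := by
    rw [einstein]; ring
  rw [schouten, stress, h, hLow]
  have h6 : 6 * algebraMap ℝ A (1 / 6) = 1 := six_sixth
  have h2 : 2 * algebraMap ℝ A (1 / 2) = 1 := two_half
  apply cancel_two
  linear_combination (3 * G.scalarCurv * G.g a b) * h2 - G.scalarCurv * G.g a b * h6
    + 2 * G.g a b * scalarCurv_eq (G := G)

theorem cu_schouten (b : Fin 4) :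
    6 * G.cu (fun a => G.schouten a b) = -(4 * G.density + 6 * G.pressure) * G.w b := by
  have h : G.cu (fun a => 3 * G.schouten a b) = G.cu (fun a => 3 * G.stress a b
    + 3 * ((G.density + G.pressure) * (G.w a * G.w b)) + G.density * G.g a b) :=
    G.cu_congr fun a => schouten_eq a b
  simp only [cu_add, cu_smul, cu_smul', cu_w, cu_g, M.cu_stress] at h
  linear_combination 2 * h

/-- The Ricci identity for the velocity, with the curvature expressed through the matter. -/
theorem ricci_identity_w (c a b : Fin 4) :
    6 * (G.nabla2 (G.nabla1 G.w) c a b - G.nabla2 (G.nabla1 G.w) a c b)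
      = -3 * (G.w c * G.stress a b - G.w a * G.stress c b)
        + (G.density + 3 * G.pressure) * (G.w c * G.g a b - G.w a * G.g c b) := by
  have h1 : ∑ e, G.riemUp e b c a * G.w e = G.cu (fun e => G.riem e b c a) := by
    simp only [← ginv_riem, cu, ← G.ginv_w, Finset.sum_mul]
    rw [Finset.sum_comm]
    exact Finset.sum_congr rfl fun f _ => Finset.sum_congr rfl fun e _ => by
      rw [G.ginv_symm e f]; ring
  have h2 := G.cu_congr fun e => M.two_mul_riem e b c a
  simp only [cu_add, cu_sub, cu_smul, cu_smul', cu_g] at h2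
  have h3 := G.ricci_identity1 G.w c a b
  rw [h1] at h3
  have h4 := M.cu_schouten c
  have h5 := M.cu_schouten a
  have h6 := schouten_eq (G := G) b a
  have h7 := schouten_eq (G := G) b c
  rw [G.g_symm b a, M.stress_symm b a] at h6
  rw [G.g_symm b c, M.stress_symm b c] at h7
  rw [G.g_symm b a, G.g_symm b c] at h2
  apply cancel_two
  linear_combination 12 * h3 - 6 * h2 + G.g c b * h5 - G.g a b * h4 - 2 * G.w c * h6
    + 2 * G.w a * h7

theorem nabla2_nabla_w (c a b : Fin 4) : G.nabla2 (G.nabla1 G.w) c a b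
    = -(G.dot0 G.hubble * G.w c) * G.hLow a b
      + G.hubble * (G.nabla1 G.w c a * G.w b + G.w a * G.nabla1 G.w c b)
      + G.nabla2 G.shear c a b := by
  have h : G.nabla1 G.w = fun a b => G.hubble * G.hLow a b + G.shear a b :=
    funext fun a => funext fun b => M.nabla_w a b
  conv_lhs => rw [h]
  rw [nabla2_add, nabla2_smul, nabla2_hLow, M.d_hubble]

/-- The Ricci identity for the velocity after inserting `∇_a u_b = θ h_{ab} + σ_{ab}`. -/
theorem codazzi_stress (c a b : Fin 4) :
    6 * (-(G.dot0 G.hubble + G.hubble ^ 2) * (G.w c * G.hLow a b - G.w a * G.hLow c b)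
      - G.hubble * (G.w c * G.shear a b - G.w a * G.shear c b)
      + G.nabla2 G.shear c a b - G.nabla2 G.shear a c b)
      = -3 * (G.w c * G.stress a b - G.w a * G.stress c b)
        + (G.density + 3 * G.pressure) * (G.w c * G.hLow a b - G.w a * G.hLow c b) := by
  have h := M.ricci_identity_w c a b
  rw [M.nabla2_nabla_w, M.nabla2_nabla_w, M.nabla_w_symm a c, M.nabla_w a b, M.nabla_w c b] at h
  simp only [hLow] at h ⊢
  linear_combination h

/-- The time component of the Ricci identity for the velocity. -/
theorem shear_expansion_evolution (a b : Fin 4) :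
    6 * ((G.dot0 G.hubble + G.hubble ^ 2) * G.hLow a b
      + 2 * G.hubble * G.shear a b + G.dot2 G.shear a b)
      = 3 * G.stress a b - (G.density + 3 * G.pressure) * G.hLow a b := by
  have h := G.cu_congr fun c => M.codazzi_stress c a b
  simp only [cu_add, cu_sub, cu_smul, cu_smul', cu_w, cu_hLow, cu_shear, M.cu_stress,
    ← dot2_eq, M.cu_nabla2 M.shear_mem G.cu_shear] at h
  linear_combination h

/-- The Raychaudhuri equation. -/
theorem raychaudhuri :
    6 * (G.dot0 G.hubble + G.hubble ^ 2) = -(G.density + 3 * G.pressure) := by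
  have h := G.tr_congr fun a b => M.shear_expansion_evolution a b
  simp only [tr_add, tr_sub, tr_smul, tr_hLow, tr_shear, tr_stress, G.tr_dot2 G.tr_shear] at h
  apply cancel_six
  linear_combination 2 * h

/-- The evolution of the shear is driven by the anisotropic stress. -/
theorem stress_eq (a b : Fin 4) :
    G.stress a b = 2 * G.dot2 G.shear a b + 4 * G.hubble * G.shear a b := by
  have h := M.shear_expansion_evolution a b
  apply cancel_six
  linear_combination -2 * h + 2 * G.hLow a b * M.raychaudhuri

/-- The Codazzi equation: up to time components, `∇_c σ_{ab}` is totally symmetric. -/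
theorem codazzi (c a b : Fin 4) : G.nabla2 G.shear c a b = G.nabla2 G.shear a c b
    - G.w c * (G.dot2 G.shear a b + G.hubble * G.shear a b)
    + G.w a * (G.dot2 G.shear c b + G.hubble * G.shear c b) := by
  have h := M.codazzi_stress c a b
  rw [M.stress_eq, M.stress_eq] at h
  apply cancel_six
  linear_combination h + (G.w c * G.hLow a b - G.w a * G.hLow c b) * M.raychaudhuri

theorem stress_mem (a b : Fin 4) : G.stress a b ∈ I := by
  rw [M.stress_eq]
  exact I.add_mem (I.mul_mem_left _ (M.dot2_mem M.shear_mem a b))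
    (I.mul_mem_left _ (M.shear_mem a b))

theorem two_mul_nabla4_riem (e a b c d : Fin 4) : 2 * G.nabla4 G.riem e a b c d
    = G.g a c * G.nabla2 G.schouten e b d - G.g a d * G.nabla2 G.schouten e b c
      - G.g b c * G.nabla2 G.schouten e a d + G.g b d * G.nabla2 G.schouten e a c := by
  have h : G.riem = fun a b c d => algebraMap ℝ A (1 / 2) * (G.g a c * G.schouten b d
      - G.g a d * G.schouten b c - G.g b c * G.schouten a d + G.g b d * G.schouten a c) := by
    funext a b c d
    apply cancel_two
    rw [M.two_mul_riem, ← mul_assoc, two_half, one_mul]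
  have h2 : G.nabla4 G.riem e a b c d = algebraMap ℝ A (1 / 2) *
      (G.g a c * G.nabla2 G.schouten e b d - G.g a d * G.nabla2 G.schouten e b c
      - G.g b c * G.nabla2 G.schouten e a d + G.g b d * G.nabla2 G.schouten e a c) := by
    rw [h]
    simp only [nabla4, nabla2, Fin.sum_univ_four, map_add, map_sub, Derivation.leibniz,
      smul_eq_mul, d_g, Derivation.map_algebraMap]
    ring
  rw [h2, ← mul_assoc, two_half, one_mul]

/-- A conformally flat spacetime has vanishing Cotton tensor, by the twice contracted second
Bianchi identity. -/
theorem cotton (e d b : Fin 4) : G.nabla2 G.schouten e d b = G.nabla2 G.schouten d e b := by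
  have hs : ∀ e a b, G.nabla2 G.schouten e a b = G.nabla2 G.schouten e b a := fun e a b => by
    have h : G.schouten = fun a b => G.schouten b a :=
      funext fun a => funext fun b => M.schouten_symm a b
    conv_lhs => rw [h, nabla2_swap]
  have hg : G.tr (fun a b => G.g a b) = 4 := G.tr_g
  -- The contraction of the Bianchi identity with `g^{ac}`.
  have h1 : ∀ e b d, G.nabla2 G.schouten e b d - G.nabla2 G.schouten d b e
      + G.g b d * (G.tr (fun a c => G.nabla2 G.schouten e a c)
        - G.tr (fun a c => G.nabla2 G.schouten c a e))
      - G.g b e * (G.tr (fun a c => G.nabla2 G.schouten d a c)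
        - G.tr (fun a c => G.nabla2 G.schouten c a d)) = 0 := by
    intro e b d
    have h : G.tr (fun a c => 2 * G.nabla4 G.riem e a b c d + 2 * G.nabla4 G.riem c a b d e
        + 2 * G.nabla4 G.riem d a b e c) = 0 := by
      have h0 : ∀ a c, 2 * G.nabla4 G.riem e a b c d + 2 * G.nabla4 G.riem c a b d e
          + 2 * G.nabla4 G.riem d a b e c = 0 := fun a c => by
        linear_combination 2 * G.bianchi2 e a b c d
      simp only [h0]
      simp [tr]
    simp only [M.two_mul_nabla4_riem, tr_add, tr_sub, tr_smul, tr_smul', tr_g_left, tr_g_right',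
      hg] at h
    linear_combination h
  -- A second contraction removes the trace terms.
  have h2 : ∀ e, G.tr (fun a c => G.nabla2 G.schouten e a c)
        - G.tr (fun a c => G.nabla2 G.schouten c a e) = 0 := by
    intro e
    have h := G.tr_congr fun b d => h1 e b d
    simp only [tr_add, tr_sub, tr_smul', tr_g_left, hg] at h
    have h0 : G.tr (fun _ _ => 0) = 0 := by simp [tr]
    rw [h0] at h
    apply cancel_two
    apply cancel_two
    linear_combination h
  have h := h1 e b d
  rw [h2, h2] at h
  rw [hs e d b, hs d e b]
  linear_combination h

theorem nabla2_schouten (c a b : Fin 4) : 3 * G.nabla2 G.schouten c a b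
    = 3 * G.nabla2 G.stress c a b
      - 3 * ((G.dot0 G.density + G.dot0 G.pressure) * G.w c * (G.w a * G.w b))
      + 3 * ((G.density + G.pressure)
          * (G.nabla1 G.w c a * G.w b + G.w a * G.nabla1 G.w c b))
      - G.dot0 G.density * G.w c * G.g a b := by
  have h : G.schouten = fun a b => (G.stress a b
      + (G.density + G.pressure) * (G.w a * G.w b))
      + algebraMap ℝ A (1 / 3) * G.density * G.g a b := by
    funext a b
    have h := schouten_eq (G := G) a b
    linear_combination algebraMap ℝ A (1 / 3) * h - (G.schouten a b - G.stress a b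
      - (G.density + G.pressure) * (G.w a * G.w b)) * three_third (A := A)
  rw [h, nabla2_add, nabla2_add, nabla2_smul, nabla2_smul, nabla2_mul, nabla_g]
  have hd : G.d c (algebraMap ℝ A (1 / 3) * G.density)
      = algebraMap ℝ A (1 / 3) * G.d c G.density := by simp
  rw [hd, map_add, M.d_density, M.d_pressure]
  linear_combination -(G.dot0 G.density * G.w c * G.g a b) * three_third (A := A)

/-- The time component of the vanishing of the Cotton tensor. -/
theorem stress_energy_evolution (a b : Fin 4) : 3 * (G.dot2 G.stress a b + G.hubble * G.stress a b
      + (G.density + G.pressure) * G.shear a b)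
      + (3 * (G.density + G.pressure) * G.hubble + G.dot0 G.density) * G.hLow a b = 0 := by
  have h1 : ∀ c, 3 * (G.nabla2 G.stress c a b - G.nabla2 G.stress a c b)
      + 3 * ((G.density + G.pressure) * (G.w a * G.nabla1 G.w c b - G.w c * G.nabla1 G.w a b))
      - G.dot0 G.density * (G.w c * G.g a b - G.w a * G.g c b) = 0 := by
    intro c
    have h2 := M.nabla2_schouten c a b
    have h3 := M.nabla2_schouten a c b
    rw [M.cotton c a b, M.nabla_w_symm c a] at h2
    linear_combination h3 - h2
  have h2 := G.cu_congr h1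
  simp only [cu_add, cu_sub, cu_smul, cu_smul', cu_w, cu_g, M.cu_nabla_w_left, cu_zero,
    ← dot2_eq, M.cu_nabla2 M.stress_mem M.cu_stress] at h2
  rw [M.nabla_w] at h2
  simp only [hLow] at h2 ⊢
  linear_combination h2

/-- The evolution of the anisotropic stress in the absence of the electric Weyl curvature. -/
theorem dot_stress (a b : Fin 4) : G.dot2 G.stress a b
    = -(G.hubble * G.stress a b) - (G.density + G.pressure) * G.shear a b := by
  have h4 := G.tr_dot2 (S := G.stress) tr_stress
  have h5 := G.tr_congr fun a b => M.stress_energy_evolution a b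
  simp only [tr_add, tr_smul, h4, tr_stress, tr_shear, tr_hLow] at h5
  have h0 : G.tr (fun _ _ => 0) = 0 := by simp [tr]
  rw [h0] at h5
  apply cancel_six
  have h6 : 3 * (G.density + G.pressure) * G.hubble + G.dot0 G.density = 0 := by
    apply cancel_six
    linear_combination 2 * h5
  linear_combination 2 * M.stress_energy_evolution a b - 2 * G.hLow a b * h6

/-- The second time derivative of the shear, from the evolution of the shear and of the stress. -/
theorem ddot_shear (a b : Fin 4) : 6 * G.dot2 (G.dot2 G.shear) a b
    = -18 * G.hubble * G.dot2 G.shear a b + (-G.density + 3 * G.pressure) * G.shear a b := by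
  have h : G.stress = fun a b => 2 * G.dot2 G.shear a b + 4 * G.hubble * G.shear a b :=
    funext fun a => funext fun b => M.stress_eq a b
  have h1 := M.dot_stress a b
  have h2 : G.dot2 G.stress a b = 2 * G.dot2 (G.dot2 G.shear) a b
      + 4 * (G.dot0 G.hubble * G.shear a b + G.hubble * G.dot2 G.shear a b) := by
    have h4 : ∀ n : ℕ, ∀ e, G.d e (n : A) = 0 := fun n e => by simp
    have h5 : ∀ e, G.d e (4 : A) = 0 := fun e => by exact_mod_cast h4 4 e
    have h6 : ∀ e, G.d e (2 : A) = 0 := fun e => by exact_mod_cast h4 2 e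
    rw [dot2_eq, h]
    simp only [nabla2_add, nabla2_smul, cu_add, cu_smul, cu_smul', Derivation.leibniz, smul_eq_mul,
      h5, h6, ← dot2_eq, dot0]
    simp only [zero_mul, mul_zero, cu_zero]
    ring
  rw [h2, M.stress_eq] at h1
  linear_combination 3 * h1 - 2 * G.shear a b * M.raychaudhuri

theorem dot_shear_mem (a b : Fin 4) : G.dot2 G.shear a b ∈ I := M.dot2_mem M.shear_mem a b

theorem cu_dot_shear (b : Fin 4) : G.cu (fun a => G.dot2 G.shear a b) = 0 :=
  M.cu_dot2 M.shear_mem G.cu_shear b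

omit M in
theorem dot_shear_symm (a b : Fin 4) : G.dot2 G.shear a b = G.dot2 G.shear b a :=
  G.dot2_symm G.shear_symm a b

theorem cu_dot_shear' (a : Fin 4) : G.cu (fun b => G.dot2 G.shear a b) = 0 := by
  simp only [dot_shear_symm a, M.cu_dot_shear]

theorem pstf_dot_shear (a b : Fin 4) : G.pstf (G.dot2 G.shear) a b = G.dot2 G.shear a b :=
  M.pstf_dot2 M.shear_mem G.shear_symm G.cu_shear G.tr_shear a b

theorem pstf_ddot_shear (a b : Fin 4) :
    G.pstf (G.dot2 (G.dot2 G.shear)) a b = G.dot2 (G.dot2 G.shear) a b :=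
  M.pstf_dot2 M.dot_shear_mem dot_shear_symm M.cu_dot_shear (G.tr_dot2 G.tr_shear) a b

omit M in
theorem nabla2_shear_symm (c a b : Fin 4) : G.nabla2 G.shear c a b = G.nabla2 G.shear c b a := by
  have h : G.shear = fun a b => G.shear b a :=
    funext fun a => funext fun b => G.shear_symm a b
  conv_lhs => rw [h, nabla2_swap]

/-- The divergence of the shear vanishes, by a contraction of the Codazzi equation. -/
theorem tr_nabla2_shear (b : Fin 4) : G.tr (fun d c => G.nabla2 G.shear d c b) = 0 := by
  have h := G.tr_congr fun c b' => M.codazzi c b b'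
  have h2 : G.tr (fun c b' => G.nabla2 G.shear b c b') = 0 := by
    rw [← G.d_tr]
    have : G.tr G.shear = 0 := G.tr_shear
    rw [this, map_zero]
  have h3 : G.tr (fun c b' => G.nabla2 G.shear c b b')
      = G.tr (fun d c => G.nabla2 G.shear d c b) := G.tr_congr fun c b' => nabla2_shear_symm c b b'
  have h4 := G.tr_dot2 (S := G.shear) G.tr_shear
  simp only [tr_add, tr_sub, tr_smul, tr_w_left, h2, h3, h4, cu_add, cu_smul, M.cu_dot_shear',
    cu_shear', tr_shear] at h
  linear_combination h

omit M in
theorem D2_eq (S : Fin 4 → Fin 4 → A) (c a b : Fin 4) : G.D2 S c a b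
    = G.proj2 (fun p q => G.nabla2 S p q b + G.cu (fun r => G.nabla2 S p q r) * G.w b) c a := by
  simp only [D2, proj2, mul_assoc, ← Finset.mul_sum, sum_hMix]

/-- The projected derivative of the shear. -/
theorem D2_shear (c a b : Fin 4) : G.D2 G.shear c a b = G.nabla2 G.shear c a b
    + G.w c * G.dot2 G.shear a b - G.hubble * (G.w a * G.shear c b)
    - G.hubble * (G.w b * G.shear c a) := by
  rw [D2_eq, proj2_eq]
  simp only [M.cu_nabla2' M.shear_mem G.shear_symm G.cu_shear, cu_add, cu_smul, cu_smul', cu_neg,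
    cu_shear, cu_shear', M.cu_nabla2 M.shear_mem G.cu_shear, ← dot2_eq]
  rw [G.shear_symm c a]
  ring

theorem div2_shear (a : Fin 4) : G.div2 G.shear a = 0 := by
  have h : G.div2 G.shear a = G.trh (fun b c => G.D2 G.shear c a b) := rfl
  have h1 : G.tr (fun b c => G.nabla2 G.shear c a b) = 0 := by
    rw [← M.tr_nabla2_shear a, ← G.tr_swap]
    exact G.tr_congr fun c b => nabla2_shear_symm c a b
  have h2 : G.tr (fun b c => G.shear c b) = 0 := by rw [G.tr_swap]; exact G.tr_shear
  have h3 : G.trh (fun b c => G.nabla2 G.shear c a b) = 0 := by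
    simp only [trh_eq, h1, ← dot2_eq, M.cu_dot_shear']
    ring
  have h4 : G.trh (fun b c => G.shear c b) = 0 := by
    simp only [trh_eq, h2, cu_shear, cu_zero]
    ring
  rw [h]
  simp only [M.D2_shear, trh_add, trh_sub, trh_smul, trh_w_left, trh_w_right, h3, h4]
  ring

/-- The contraction `u^d u^c ∇_a ∇_d σ_{cb}`, by moving `u^d` and `u^c` inside the derivatives. -/
theorem cu_cu_nabla3_shear (a b : Fin 4) :
    G.cu (fun d => G.cu fun c => G.nabla3 (G.nabla2 G.shear) a d c b)
      = -(G.hubble * G.dot2 G.shear a b) + G.hubble ^ 2 * G.shear a b := by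
  have h : ∀ c, G.cu (fun d => G.nabla3 (G.nabla2 G.shear) a d c b)
      = G.nabla2 (G.dot2 G.shear) a c b
        - G.hubble * (G.nabla2 G.shear a c b + G.w a * G.dot2 G.shear c b) := by
    intro c
    have h1 := G.nabla2_cu a c b (G.nabla2 G.shear)
    rw [M.tr_nabla_w fun q => M.nabla2_mem M.shear_mem q c b] at h1
    have h2 : (fun a b => G.cu fun e => G.nabla2 G.shear e a b) = G.dot2 G.shear := rfl
    rw [h2, ← dot2_eq] at h1
    linear_combination -h1
  rw [G.cu_cu_comm]
  simp only [h, cu_sub, cu_smul, cu_add, M.cu_dot_shear,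
    M.cu_nabla2 M.shear_mem G.cu_shear, M.cu_nabla2 M.dot_shear_mem M.cu_dot_shear]
  ring

/-- The curvature acting on one slot of the shear. The anisotropic stress drops out, being of first
order. -/
theorem riemUp_shear (c d a b : Fin 4) : 6 * ∑ e, G.riemUp e c d a * G.shear e b
    = 3 * ((G.density + G.pressure) * (G.w c * G.w a * G.shear d b - G.w c * G.w d * G.shear a b))
      + 2 * G.density * (G.g c a * G.shear d b - G.g c d * G.shear a b) := by
  have h1 : ∑ e, G.riemUp e c d a * G.shear e b
      = G.tr (fun f e => G.riem f c d a * G.shear e b) := by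
    simp only [← ginv_riem, tr, Finset.sum_mul]
    rw [Finset.sum_comm]
    exact Finset.sum_congr rfl fun f _ => Finset.sum_congr rfl fun e _ => by
      rw [G.ginv_symm e f]; ring
  have h2 : ∀ f e, 6 * (G.riem f c d a * G.shear e b) =
      (3 * G.schouten c a) * (G.g f d * G.shear e b) - (3 * G.schouten c d) * (G.g f a * G.shear e b)
      - (G.g c d) * ((3 * G.schouten f a) * G.shear e b)
      + (G.g c a) * ((3 * G.schouten f d) * G.shear e b) := fun f e => by
    linear_combination 3 * G.shear e b * M.two_mul_riem f c d a
  have h3 : ∀ a, G.tr (fun f e => (3 * G.schouten f a) * G.shear e b)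
      = G.density * G.shear a b := by
    intro a
    have h := M.tr_mul_eq_zero (fun f => G.stress f a) (fun e => G.shear e b)
      (fun f => M.stress_mem f a) (fun e => M.shear_mem e b)
    simp only [schouten_eq, add_mul, mul_assoc, tr_add, tr_smul, tr_w_left, cu_smul, cu_shear,
      tr_g_left, h]
    ring
  have h4 := G.tr_congr h2
  simp only [tr_add, tr_sub, tr_smul, h3, tr_g_left] at h4
  have h5 : ∀ a d, G.stress c a * G.shear d b = 0 := fun a d =>
    M.mul_eq_zero _ (M.stress_mem c a) _ (M.shear_mem d b)
  rw [h1, h4, schouten_eq, schouten_eq]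
  linear_combination 3 * h5 a d - 3 * h5 d a

/-- The Ricci identity for the shear with the background curvature. -/
theorem commutator_shear (d a c b : Fin 4) :
    6 * (G.nabla3 (G.nabla2 G.shear) d a c b - G.nabla3 (G.nabla2 G.shear) a d c b)
    = -(3 * ((G.density + G.pressure) * (G.w c * G.w a * G.shear d b - G.w c * G.w d * G.shear a b))
      + 2 * G.density * (G.g c a * G.shear d b - G.g c d * G.shear a b))
      - (3 * ((G.density + G.pressure) * (G.w b * G.w a * G.shear d c - G.w b * G.w d * G.shear a c))
      + 2 * G.density * (G.g b a * G.shear d c - G.g b d * G.shear a c)) := by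
  rw [G.ricci_identity2, ← M.riemUp_shear, ← M.riemUp_shear]
  simp only [G.shear_symm c]
  ring

theorem trh_commutator (a b : Fin 4) :
    G.trh (fun d c => G.nabla3 (G.nabla2 G.shear) d a c b)
      = G.trh (fun d c => G.nabla3 (G.nabla2 G.shear) a d c b) + G.density * G.shear a b := by
  have h := G.trh_congr fun d c => M.commutator_shear d a c b
  have ht : G.trh (fun d c => G.shear d c) = 0 := by
    rw [trh_eq, tr_shear]; simp only [cu_shear', cu_zero, add_zero]
  have hg : G.trh (fun d c => G.g c d) = 3 := by
    have hg : G.tr (fun d c => G.g c d) = 4 := by rw [G.tr_swap]; exact G.tr_g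
    simp only [trh_eq, hg, cu_g, cu_w]
    norm_num
  simp only [trh_add, trh_sub, trh_smul, trh_smul', trh_neg, mul_assoc, trh_w_left, trh_w_right,
    trh_g_left, trh_g_right, cu_shear, cu_shear', ht, hg] at h
  apply cancel_six
  linear_combination h

theorem trh_nabla_w : G.trh (fun d c => G.nabla1 G.w d c) = 3 * G.hubble := by
  have h : G.trh (fun d c => G.nabla1 G.w d c) = G.tr (fun d c => G.nabla1 G.w d c) :=
    G.trh_of_spatial G.cu_nabla_w
  rw [h]
  simp only [M.nabla_w, tr_add, tr_smul, tr_hLow, tr_shear]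
  ring

theorem trh_nabla_w_mul {V : Fin 4 → A} (hV : ∀ a, V a ∈ I) (h1 : G.cu V = 0) (a : Fin 4) :
    G.trh (fun d c => G.nabla1 G.w d a * V c) = G.hubble * V a := by
  have h := M.tr_nabla_w hV a
  simp only [h1, M.nabla_w_symm a] at h
  simp only [trh_eq, h, cu_smul, h1, mul_zero, cu_zero]
  ring

/-- The Laplacian of the shear before its free indices are projected. The Codazzi equation exchanges
the derivative index with an index of the shear, which leaves a commutator, a divergence, and a
multiple of `u_a`. -/
theorem exists_trh_nabla3_shear : ∃ V : Fin 4 → A, ∀ a b,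
    G.trh (fun d c => G.nabla3 (G.nabla2 G.shear) d c a b)
      = G.density * G.shear a b - 3 * G.hubble * G.dot2 G.shear a b - G.hubble ^ 2 * G.shear a b
        + G.w a * V b := by
  obtain ⟨N, hN⟩ : ∃ N, N = fun a b => G.dot2 G.shear a b + G.hubble * G.shear a b := ⟨_, rfl⟩
  have hNmem : ∀ a b, N a b ∈ I := fun a b => by
    rw [hN]; exact I.add_mem (M.dot_shear_mem a b) (I.mul_mem_left _ (M.shear_mem a b))
  have hNcu : ∀ b, G.cu (fun a => N a b) = 0 := fun b => by
    simp only [hN, cu_add, cu_smul, M.cu_dot_shear, cu_shear]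
    ring
  have hcod : G.nabla2 G.shear = fun c a b => G.nabla2 G.shear a c b
      + (G.w a * N c b + (-1) * (G.w c * N a b)) := by
    funext c a b
    rw [M.codazzi, hN]
    ring
  refine ⟨fun b => G.trh (fun d c => G.nabla2 N d c b), fun a b => ?_⟩
  have h1 : ∀ d c, G.nabla3 (G.nabla2 G.shear) d c a b
      = G.nabla3 (G.nabla2 G.shear) d a c b
        + (G.nabla1 G.w d a * N c b + G.w a * G.nabla2 N d c b)
        - (G.nabla1 G.w d c * N a b + G.w c * G.nabla2 N d a b) := by
    intro d c
    conv_lhs => rw [hcod]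
    rw [nabla3_add, nabla3_swap12, nabla3_add, nabla3_smul, nabla3_mul,
      G.nabla3_swap12 fun a c b => G.w a * N c b, nabla3_mul]
    simp only [map_neg, Derivation.map_one_eq_zero]
    ring
  have h2 : G.trh (fun d c => G.nabla3 (G.nabla2 G.shear) a d c b)
      = -(G.hubble * G.dot2 G.shear a b) + G.hubble ^ 2 * G.shear a b := by
    rw [trh_eq, ← nabla1_tr, M.cu_cu_nabla3_shear]
    simp only [M.tr_nabla2_shear, nabla1_zero]
    ring
  have h3 := G.trh_congr h1
  simp only [trh_add, trh_sub, trh_smul, trh_smul', trh_w_right, M.trh_nabla_w,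
    M.trh_nabla_w_mul (fun c => hNmem c b) (hNcu b), M.trh_commutator, h2] at h3
  rw [h3, hN]
  ring

omit M in
theorem proj2_add (S T : Fin 4 → Fin 4 → A) (a b : Fin 4) :
    G.proj2 (fun a b => S a b + T a b) a b = G.proj2 S a b + G.proj2 T a b := by
  simp only [proj2, mul_add, Finset.sum_add_distrib]

omit M in
theorem proj2_w_mul (V : Fin 4 → A) (a b : Fin 4) : G.proj2 (fun a b => G.w a * V b) a b = 0 := by
  simp only [proj2_eq, cu_smul, cu_smul', cu_w]
  ring

omit M in
/-- The projections of the derivative indices may be dropped under the spatial trace. -/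
theorem lap2_eq (S : Fin 4 → Fin 4 → A) (a b : Fin 4) : G.lap2 S a b
    = G.proj2 (fun q r => G.trh fun d c => G.nabla3 (G.D2 S) d c q r) a b := by
  have h : ∀ d c, G.D3 (G.D2 S) d c a b = ∑ q, ∑ r, G.hMix q a * G.hMix r b *
      G.proj2 (fun o p => G.nabla3 (G.D2 S) o p q r) d c := by
    intro d c
    rw [D3, sum_rotate]
    simp only [proj2, Finset.mul_sum]
    exact Finset.sum_congr rfl fun q _ => Finset.sum_congr rfl fun r _ =>
      Finset.sum_congr rfl fun o _ => Finset.sum_congr rfl fun p _ => by ring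
  have h2 : G.lap2 S a b = ∑ q, ∑ r, G.hMix q a * G.hMix r b *
      G.trh (fun d c => G.proj2 (fun o p => G.nabla3 (G.D2 S) o p q r) d c) := by
    simp only [lap2, h, trh, Finset.mul_sum]
    rw [sum_rotate]
    exact Finset.sum_congr rfl fun q _ => Finset.sum_congr rfl fun r _ =>
      Finset.sum_congr rfl fun o _ => Finset.sum_congr rfl fun p _ => by ring
  have h3 : ∀ Y : Fin 4 → Fin 4 → A, G.trh (fun d c => G.proj2 Y d c) = G.trh Y := by
    intro Y
    simp only [proj2_eq, trh_add, mul_comm _ (G.w _), trh_w_left, trh_w_right]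
    ring
  rw [h2, proj2]
  simp only [h3]

/-- The Laplacian of the shear is proportional to the shear: `curl curl σ = 0` in other words, as
the magnetic Weyl curvature `curl σ` vanishes. -/
theorem lap2_shear (a b : Fin 4) : G.lap2 G.shear a b
    = (G.density - 3 * G.hubble ^ 2) * G.shear a b := by
  have hX : G.D2 G.shear = fun c a b => (G.nabla2 G.shear c a b + G.w c * G.dot2 G.shear a b)
      + (-G.hubble) * (G.w a * G.shear c b + G.w b * G.shear c a) := by
    funext c a b
    rw [M.D2_shear]
    ring
  have hdiv : ∀ b, G.trh (fun d c => G.nabla2 G.shear d c b) = 0 := by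
    intro b
    rw [trh_eq, M.tr_nabla2_shear, G.cu_cu_comm]
    simp only [← dot2_eq, M.cu_dot_shear, zero_add]
  have hK := fun b => M.trh_nabla_w_mul (fun c => M.shear_mem c b) (G.cu_shear b)
  obtain ⟨V, hV⟩ := M.exists_trh_nabla3_shear
  have h : ∀ a b, G.trh (fun d c => G.nabla3 (G.D2 G.shear) d c a b)
      = (G.density - 3 * G.hubble ^ 2) * G.shear a b + G.w a * V b := by
    intro a b
    have h1 : ∀ d c, G.nabla3 (G.D2 G.shear) d c a b
        = G.nabla3 (G.nabla2 G.shear) d c a b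
          + (G.nabla1 G.w d c * G.dot2 G.shear a b + G.w c * G.nabla2 (G.dot2 G.shear) d a b)
          + (G.w d * (G.dot0 G.hubble * (G.w a * G.shear c b + G.w b * G.shear c a))
          - G.hubble * (G.nabla1 G.w d a * G.shear c b + G.w a * G.nabla2 G.shear d c b
            + (G.nabla1 G.w d b * G.shear c a + G.w b * G.nabla2 G.shear d c a))) := by
      intro d c
      rw [hX, nabla3_add, nabla3_add, nabla3_smul, nabla3_add, nabla3_mul,
        G.nabla3_swap12 fun a c b => G.w a * G.shear c b, nabla3_mul,
        G.nabla3_swap23 fun c b a => G.w b * G.shear c a,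
        G.nabla3_swap12 fun b c a => G.w b * G.shear c a, nabla3_mul, map_neg, M.d_hubble]
      ring
    have h2 := G.trh_congr h1
    simp only [trh_add, trh_sub, trh_smul, trh_smul', trh_w_left, trh_w_right, M.trh_nabla_w, hV,
      hK, hdiv] at h2
    rw [h2, G.shear_symm b a]
    ring
  have hp : ∀ a b, G.proj2 (fun a b => (G.density - 3 * G.hubble ^ 2) * G.shear a b) a b
      = (G.density - 3 * G.hubble ^ 2) * G.shear a b := fun a b =>
    G.proj2_of_spatial (fun b => by rw [cu_smul, cu_shear, mul_zero])
      (fun a => by rw [cu_smul, cu_shear', mul_zero]) a b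
  rw [lap2_eq]
  simp only [h, proj2_add, proj2_w_mul, hp, add_zero]

/-- The wave equation for the shear, as `σ̈_{ab}` and `D² σ_{ab}` are separately determined by the
shear and its first time derivative. -/
theorem wave_equation (a b : Fin 4) :
    G.pstf (G.dot2 (G.dot2 G.shear)) a b - G.lap2 G.shear a b
      = -G.expansion * G.pstf (G.dot2 G.shear) a b
        + (algebraMap ℝ A (1 / 3) * G.expansion ^ 2 - algebraMap ℝ A (7 / 6) * G.density
          + algebraMap ℝ A (1 / 2) * G.pressure) * G.shear a b := by
  rw [M.pstf_ddot_shear, M.pstf_dot_shear, M.lap2_shear, ← three_hubble]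
  have h := M.ddot_shear a b
  have h3 : 3 * algebraMap ℝ A (1 / 3) = 1 := three_third
  have h2 : 2 * algebraMap ℝ A (1 / 2) = 1 := two_half
  have h7 : 6 * algebraMap ℝ A (7 / 6) = 7 := by
    rw [← map_ofNat (algebraMap ℝ A) 6, ← map_mul, ← map_ofNat (algebraMap ℝ A) 7]
    norm_num
  apply cancel_six
  linear_combination h - (18 * G.hubble ^ 2 * G.shear a b) * h3
    + G.density * G.shear a b * h7 - 3 * G.pressure * G.shear a b * h2

end IsTensorMode
end Spacetime

/-! ### Scalar fields in the linearised regime -/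

open ConfFlat

/-- A domain `(-ε₀, ε₀) × U` of a one-parameter family of fields on a coordinate patch. -/
structure Patch where
  /-- The bound on the perturbation parameter. -/
  ε₀ : ℝ
  /-- The coordinate patch. -/
  U : Set Pt
  pos : 0 < ε₀
  isOpen : IsOpen U

namespace Patch

variable (P : Patch)

/-- The set `(-ε₀, ε₀) × U`. -/
def dom : Set (ℝ × Pt) := Set.Ioo (-P.ε₀) P.ε₀ ×ˢ P.U

theorem isOpen_dom : IsOpen P.dom := isOpen_Ioo.prod P.isOpen

theorem zero_mem_dom {x : Pt} (hx : x ∈ P.U) : ((0 : ℝ), x) ∈ P.dom :=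
  ⟨⟨neg_lt_zero.2 P.pos, P.pos⟩, hx⟩

/-- The smooth one-parameter families of scalar fields. Their values outside the domain are
arbitrary. -/
def smooth : Subalgebra ℝ (ℝ → Pt → ℝ) where
  carrier := {f | ContDiffOn ℝ ∞ (fun z : ℝ × Pt => f z.1 z.2) P.dom}
  mul_mem' hf hg := ContDiffOn.mul hf hg
  add_mem' hf hg := ContDiffOn.add hf hg
  algebraMap_mem' _ := contDiffOn_const

variable {P}

theorem contDiffOn {f : ℝ → Pt → ℝ} (hf : f ∈ P.smooth) :
    ContDiffOn ℝ ∞ (fun z : ℝ × Pt => f z.1 z.2) P.dom := hf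

theorem contDiffAt {f : ℝ → Pt → ℝ} (hf : f ∈ P.smooth) {z : ℝ × Pt} (hz : z ∈ P.dom) :
    ContDiffAt ℝ ∞ (fun z : ℝ × Pt => f z.1 z.2) z :=
  (contDiffOn hf).contDiffAt (P.isOpen_dom.mem_nhds hz)

theorem differentiableAt {f : ℝ → Pt → ℝ} (hf : f ∈ P.smooth) {z : ℝ × Pt} (hz : z ∈ P.dom) :
    DifferentiableAt ℝ (fun z : ℝ × Pt => f z.1 z.2) z :=
  (contDiffAt hf hz).differentiableAt (by simp)

theorem mem_smooth_congr {f h : ℝ → Pt → ℝ} (hf : f ∈ P.smooth)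
    (e : ∀ z ∈ P.dom, h z.1 z.2 = f z.1 z.2) : h ∈ P.smooth :=
  ContDiffOn.congr (contDiffOn hf) e

theorem hasFDerivAt_slice {f : ℝ → Pt → ℝ} (hf : f ∈ P.smooth) {ε : ℝ} {x : Pt}
    (hz : (ε, x) ∈ P.dom) : HasFDerivAt (f ε)
      ((fderiv ℝ (fun z : ℝ × Pt => f z.1 z.2) (ε, x)).comp
        (ContinuousLinearMap.inr ℝ ℝ Pt)) x := by
  have h := (differentiableAt hf hz).hasFDerivAt
  have h2 : HasFDerivAt (fun y : Pt => (ε, y)) (ContinuousLinearMap.inr ℝ ℝ Pt) x :=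
    hasFDerivAt_prodMk_right ε x
  exact HasFDerivAt.comp x h h2

/-- The partial derivative along the patch is a directional derivative of the family. -/
theorem pd_eq {f : ℝ → Pt → ℝ} (hf : f ∈ P.smooth) (c : Fin 4) {ε : ℝ} {x : Pt}
    (hz : (ε, x) ∈ P.dom) :
    pd c (f ε) x = fderiv ℝ (fun z : ℝ × Pt => f z.1 z.2) (ε, x) (0, Pi.single c 1) := by
  rw [pd, (hasFDerivAt_slice hf hz).fderiv]
  rfl

theorem fderiv_mem {f : ℝ → Pt → ℝ} (hf : f ∈ P.smooth) (v : ℝ × Pt) :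
    (fun ε x => fderiv ℝ (fun z : ℝ × Pt => f z.1 z.2) (ε, x) v) ∈ P.smooth := by
  have h : ContDiffOn ℝ ∞ (fderiv ℝ (fun z : ℝ × Pt => f z.1 z.2)) P.dom :=
    (contDiffOn hf).fderiv_of_isOpen P.isOpen_dom (by simp)
  exact h.clm_apply contDiffOn_const

theorem pd_mem {f : ℝ → Pt → ℝ} (hf : f ∈ P.smooth) (c : Fin 4) :
    (fun ε x => pd c (f ε) x) ∈ P.smooth :=
  mem_smooth_congr (fderiv_mem hf (0, Pi.single c 1)) fun _ hz => pd_eq hf c hz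

theorem fderiv_fderiv_comm {f : ℝ → Pt → ℝ} (hf : f ∈ P.smooth) (v w : ℝ × Pt) {z : ℝ × Pt}
    (hz : z ∈ P.dom) :
    fderiv ℝ (fun z => fderiv ℝ (fun z : ℝ × Pt => f z.1 z.2) z v) z w
      = fderiv ℝ (fun z => fderiv ℝ (fun z : ℝ × Pt => f z.1 z.2) z w) z v := by
  have h : ContDiffAt ℝ ∞ (fderiv ℝ (fun z : ℝ × Pt => f z.1 z.2)) z :=
    ((contDiffOn hf).fderiv_of_isOpen P.isOpen_dom (m := ∞) (by simp)).contDiffAt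
      (P.isOpen_dom.mem_nhds hz)
  have hd := (h.differentiableAt (by simp)).hasFDerivAt
  have h1 : ∀ v w, fderiv ℝ (fun z => fderiv ℝ (fun z : ℝ × Pt => f z.1 z.2) z v) z w
      = fderiv ℝ (fderiv ℝ (fun z : ℝ × Pt => f z.1 z.2)) z w v := by
    intro v w
    have := (hd.clm_apply (hasFDerivAt_const v z)).fderiv
    rw [this]
    simp
  rw [h1, h1]
  have hs : IsSymmSndFDerivAt ℝ (fun z : ℝ × Pt => f z.1 z.2) z :=
    (contDiffAt hf hz).isSymmSndFDerivAt (by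
      rw [minSmoothness_of_isRCLikeNormedField]; exact WithTop.coe_le_coe.2 (le_top (a := 2)))
  exact hs w v

theorem fderiv_congr {f h : ℝ → Pt → ℝ} (e : ∀ z ∈ P.dom, f z.1 z.2 = h z.1 z.2) {z : ℝ × Pt}
    (hz : z ∈ P.dom) :
    fderiv ℝ (fun z : ℝ × Pt => f z.1 z.2) z = fderiv ℝ (fun z : ℝ × Pt => h z.1 z.2) z :=
  Filter.EventuallyEq.fderiv_eq (Filter.eventually_of_mem (P.isOpen_dom.mem_nhds hz) e)

theorem pd_comm {f : ℝ → Pt → ℝ} (hf : f ∈ P.smooth) (b c : Fin 4) {ε : ℝ} {x : Pt}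
    (hz : (ε, x) ∈ P.dom) :
    pd b (fun y => pd c (f ε) y) x = pd c (fun y => pd b (f ε) y) x := by
  rw [pd_eq (f := fun ε x => pd c (f ε) x) (pd_mem hf c) b hz,
    pd_eq (f := fun ε x => pd b (f ε) x) (pd_mem hf b) c hz]
  rw [fderiv_congr (f := fun ε x => pd c (f ε) x)
      (h := fun ε x => fderiv ℝ (fun z : ℝ × Pt => f z.1 z.2) (ε, x) (0, Pi.single c 1))
      (fun z hz => pd_eq hf c hz) hz,
    fderiv_congr (f := fun ε x => pd b (f ε) x)
      (h := fun ε x => fderiv ℝ (fun z : ℝ × Pt => f z.1 z.2) (ε, x) (0, Pi.single b 1))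
      (fun z hz => pd_eq hf b hz) hz]
  exact fderiv_fderiv_comm hf _ _ hz

theorem pd_eq_zero {f : Pt → ℝ} (c : Fin 4) (hf : ∀ x ∈ P.U, f x = 0) {x : Pt} (hx : x ∈ P.U) :
    pd c f x = 0 := by
  have h : f =ᶠ[𝓝 x] fun _ => 0 := Filter.eventually_of_mem (P.isOpen.mem_nhds hx) hf
  rw [pd, h.fderiv_eq]
  simp

/-- A smooth family is negligible at a point if and only if it and its first derivative in the
perturbation parameter vanish there. -/
theorem eqFirstOrder_iff {f : ℝ → Pt → ℝ} (hf : f ∈ P.smooth) {x : Pt} (hx : x ∈ P.U) :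
    EqFirstOrder (fun ε => f ε x) (fun _ => 0) ↔
      f 0 x = 0 ∧ fderiv ℝ (fun z : ℝ × Pt => f z.1 z.2) (0, x) (1, 0) = 0 := by
  have h := (differentiableAt hf (P.zero_mem_dom hx)).hasFDerivAt
  have h2 : HasDerivAt (fun ε : ℝ => (ε, x)) ((1 : ℝ), (0 : Pt)) 0 :=
    (hasDerivAt_id (0 : ℝ)).prodMk (hasDerivAt_const 0 x)
  have hd : HasDerivAt (fun ε => f ε x)
      (fderiv ℝ (fun z : ℝ × Pt => f z.1 z.2) (0, x) (1, 0)) 0 :=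
    HasFDerivAt.comp_hasDerivAt (f := fun ε : ℝ => (ε, x)) (0 : ℝ) h h2
  constructor
  · intro ho
    have h0 : f 0 x = 0 := by
      have h3 : (fun ε : ℝ => f ε x - 0) =O[𝓝 0] (fun ε : ℝ => ε) :=
        Asymptotics.IsLittleO.isBigO ho
      simpa using h3.eq_zero_imp.self_of_nhds rfl
    refine ⟨h0, ?_⟩
    have h4 : HasDerivAt (fun ε => f ε x) 0 0 := by
      rw [hasDerivAt_iff_isLittleO]
      simpa [h0, EqFirstOrder] using ho
    exact hd.unique h4
  · rintro ⟨h0, h1⟩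
    rw [h1, hasDerivAt_iff_isLittleO] at hd
    simpa [h0, EqFirstOrder] using hd

/-- Negligibility survives differentiation along the patch, as `∂_c` commutes with the derivative in
the perturbation parameter and both initial values vanish on an open set. -/
theorem eqFirstOrder_pd {f : ℝ → Pt → ℝ} (hf : f ∈ P.smooth) (c : Fin 4)
    (h : ∀ x ∈ P.U, EqFirstOrder (fun ε => f ε x) (fun _ => 0)) {x : Pt} (hx : x ∈ P.U) :
    EqFirstOrder (fun ε => pd c (f ε) x) (fun _ => 0) := by
  rw [eqFirstOrder_iff (f := fun ε x => pd c (f ε) x) (pd_mem hf c) hx]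
  refine ⟨pd_eq_zero c (fun y hy => ((eqFirstOrder_iff hf hy).1 (h y hy)).1) hx, ?_⟩
  have hz := P.zero_mem_dom hx
  rw [fderiv_congr (f := fun ε x => pd c (f ε) x)
      (h := fun ε x => fderiv ℝ (fun z : ℝ × Pt => f z.1 z.2) (ε, x) (0, Pi.single c 1))
      (fun z hz => pd_eq hf c hz) hz]
  have e := fderiv_fderiv_comm hf (0, Pi.single c 1) (1, 0) hz
  refine e.trans ?_
  have e2 := pd_eq (f := fun ε x => fderiv ℝ (fun z : ℝ × Pt => f z.1 z.2) (ε, x) (1, 0))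
    (fderiv_mem hf (1, 0)) c hz
  refine e2.symm.trans ?_
  exact pd_eq_zero c (fun y hy => ((eqFirstOrder_iff hf hy).1 (h y hy)).2) hx

variable (P)

/-- The ideal of the families that are negligible in the linearised regime at every point. -/
def negligible : Ideal P.smooth where
  carrier := {f | ∀ x ∈ P.U, EqFirstOrder (fun ε => f.1 ε x) (fun _ => 0)}
  zero_mem' := fun x _ => by
    simp [EqFirstOrder]
  add_mem' := fun {f h} hf hh x hx => by
    simpa [EqFirstOrder] using Asymptotics.IsLittleO.add (hf x hx) (hh x hx)
  smul_mem' := fun f h hh x hx => by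
    have hc : ContinuousAt (fun ε => f.1 ε x) 0 :=
      ContinuousAt.comp (f := fun ε : ℝ => (ε, x))
        (differentiableAt f.2 (P.zero_mem_dom hx)).continuousAt (by fun_prop)
    have := (hc.tendsto.isBigO_one ℝ).mul_isLittleO (hh x hx)
    simpa [EqFirstOrder] using this

/-- The algebra of scalar fields in the linearised regime: smooth families up to negligible
ones. -/
def Lin : Type := P.smooth ⧸ P.negligible

instance : CommRing P.Lin := inferInstanceAs (CommRing (P.smooth ⧸ P.negligible))

instance : Algebra ℝ P.Lin := inferInstanceAs (Algebra ℝ (P.smooth ⧸ P.negligible))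

/-- The class of a smooth family. -/
def cls : P.smooth →+* P.Lin := Ideal.Quotient.mk P.negligible

theorem cls_surjective : Function.Surjective P.cls := Ideal.Quotient.mk_surjective

variable {P}

theorem cls_eq_zero {f : P.smooth} :
    P.cls f = 0 ↔ ∀ x ∈ P.U, EqFirstOrder (fun ε => f.1 ε x) (fun _ => 0) :=
  Ideal.Quotient.eq_zero_iff_mem

theorem cls_congr {f h : P.smooth} (e : ∀ z ∈ P.dom, f.1 z.1 z.2 = h.1 z.1 z.2) :
    P.cls f = P.cls h := by
  rw [← sub_eq_zero, ← P.cls.map_sub, cls_eq_zero]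
  intro x hx
  have h0 : f.1 0 x = h.1 0 x := e _ (P.zero_mem_dom hx)
  rw [eqFirstOrder_iff (f - h).2 hx]
  refine ⟨by simpa [sub_eq_zero] using h0, ?_⟩
  rw [fderiv_congr (h := fun _ _ => 0) (fun z hz => by simpa [sub_eq_zero] using e z hz)
    (P.zero_mem_dom hx)]
  simp

/-- The partial derivative of a smooth family. -/
def pdS (c : Fin 4) (f : P.smooth) : P.smooth := ⟨fun ε x => pd c (f.1 ε) x, pd_mem f.2 c⟩

theorem cls_pdS_add (c : Fin 4) (f h : P.smooth) :
    P.cls (pdS c (f + h)) = P.cls (pdS c f) + P.cls (pdS c h) := by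
  rw [← P.cls.map_add]
  refine cls_congr fun z hz => ?_
  have h1 := (hasFDerivAt_slice f.2 (ε := z.1) (x := z.2) hz)
  have h2 := (hasFDerivAt_slice h.2 (ε := z.1) (x := z.2) hz)
  change pd c (f.1 z.1 + h.1 z.1) z.2 = pd c (f.1 z.1) z.2 + pd c (h.1 z.1) z.2
  rw [pd, (h1.add h2).fderiv, pd, h1.fderiv, pd, h2.fderiv]
  rfl

theorem cls_pdS_mul (c : Fin 4) (f h : P.smooth) :
    P.cls (pdS c (f * h)) = P.cls f * P.cls (pdS c h) + P.cls h * P.cls (pdS c f) := by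
  rw [← P.cls.map_mul, ← P.cls.map_mul, ← P.cls.map_add]
  refine cls_congr fun z hz => ?_
  have h1 := (hasFDerivAt_slice f.2 (ε := z.1) (x := z.2) hz)
  have h2 := (hasFDerivAt_slice h.2 (ε := z.1) (x := z.2) hz)
  change pd c (f.1 z.1 * h.1 z.1) z.2
    = f.1 z.1 z.2 * pd c (h.1 z.1) z.2 + h.1 z.1 z.2 * pd c (f.1 z.1) z.2
  rw [pd, (h1.mul h2).fderiv, pd, pd, h1.fderiv, h2.fderiv]
  simp

theorem cls_pdS_const (c : Fin 4) (r : ℝ) : P.cls (pdS c (algebraMap ℝ P.smooth r)) = 0 := by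
  rw [← P.cls.map_zero]
  refine cls_congr fun z _ => ?_
  change pd c (fun _ => r) z.2 = 0
  simp [pd]

theorem cls_pdS_congr (c : Fin 4) {f h : P.smooth} (e : P.cls f = P.cls h) :
    P.cls (pdS c f) = P.cls (pdS c h) := by
  have h1 : P.cls (f - h) = 0 := by rw [P.cls.map_sub, e, sub_self]
  have h2 : P.cls (pdS c (f - h)) = 0 :=
    cls_eq_zero.2 fun x hx => eqFirstOrder_pd (f - h).2 c (cls_eq_zero.1 h1) hx
  have h3 := cls_pdS_add c (f - h) h
  rw [sub_add_cancel, h2, zero_add] at h3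
  exact h3

variable (P)

/-- The partial derivative on the algebra of scalar fields in the linearised regime. -/
def dLin (c : Fin 4) : Derivation ℝ P.Lin P.Lin :=
  let D : P.Lin → P.Lin := fun α =>
    P.cls (pdS c (Function.surjInv P.cls_surjective α))
  have hD : ∀ f, D (P.cls f) = P.cls (pdS c f) := fun f =>
    cls_pdS_congr c (Function.surjInv_eq P.cls_surjective _)
  have hmul : ∀ α β, D (α * β) = α * D β + β * D α := fun α β => by
    obtain ⟨f, rfl⟩ := P.cls_surjective α
    obtain ⟨h, rfl⟩ := P.cls_surjective β
    rw [← P.cls.map_mul, hD, hD, hD, cls_pdS_mul]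
  Derivation.mk'
    { toFun := D
      map_add' := fun α β => by
        obtain ⟨f, rfl⟩ := P.cls_surjective α
        obtain ⟨h, rfl⟩ := P.cls_surjective β
        rw [← P.cls.map_add, hD, hD, hD, cls_pdS_add]
      map_smul' := fun r α => by
        have h : D (algebraMap ℝ P.Lin r) = 0 := (hD _).trans (cls_pdS_const c r)
        rw [RingHom.id_apply, Algebra.smul_def, Algebra.smul_def]
        change D (_ * α) = _ * D α
        rw [hmul, h]
        ring }
    hmul

theorem dLin_cls (c : Fin 4) (f : P.smooth) : P.dLin c (P.cls f) = P.cls (pdS c f) :=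
  cls_pdS_congr c (Function.surjInv_eq P.cls_surjective _)

/-- The ideal of first-order fields, those that vanish in the background. -/
def firstOrder : Ideal P.Lin :=
  Ideal.map P.cls
    { carrier := {f : P.smooth | ∀ x ∈ P.U, f.1 0 x = 0}
      zero_mem' := fun _ _ => rfl
      add_mem' := fun {f h} hf hh x hx => by
        change f.1 0 x + h.1 0 x = 0
        rw [hf x hx, hh x hx, add_zero]
      smul_mem' := fun f h hh x hx => by
        change f.1 0 x * h.1 0 x = 0
        rw [hh x hx, mul_zero] }

theorem mem_firstOrder {α : P.Lin} :
    α ∈ P.firstOrder ↔ ∃ f : P.smooth, (∀ x ∈ P.U, f.1 0 x = 0) ∧ P.cls f = α :=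
  Ideal.mem_map_iff_of_surjective _ P.cls_surjective

/-- Products of first-order fields are negligible. -/
theorem firstOrder_mul {α β : P.Lin} (hα : α ∈ P.firstOrder) (hβ : β ∈ P.firstOrder) :
    α * β = 0 := by
  obtain ⟨f, hf, rfl⟩ := P.mem_firstOrder.1 hα
  obtain ⟨h, hh, rfl⟩ := P.mem_firstOrder.1 hβ
  rw [← P.cls.map_mul, cls_eq_zero]
  intro x hx
  rw [eqFirstOrder_iff (f * h).2 hx]
  have hz := P.zero_mem_dom hx
  refine ⟨by change f.1 0 x * h.1 0 x = 0; rw [hf x hx, zero_mul], ?_⟩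
  have h1 := (differentiableAt f.2 hz).hasFDerivAt
  have h2 := (differentiableAt h.2 hz).hasFDerivAt
  have h3 := (h1.mul h2).fderiv
  have h4 : fderiv ℝ (fun z : ℝ × Pt => (f * h).1 z.1 z.2) (0, x) = _ := h3
  rw [h4]
  simp [hf x hx, hh x hx]

theorem dLin_mem (c : Fin 4) {α : P.Lin} (hα : α ∈ P.firstOrder) : P.dLin c α ∈ P.firstOrder := by
  obtain ⟨f, hf, rfl⟩ := P.mem_firstOrder.1 hα
  rw [dLin_cls]
  exact P.mem_firstOrder.2 ⟨_, fun x hx => pd_eq_zero c hf hx, rfl⟩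

theorem dLin_comm (b c : Fin 4) (α : P.Lin) : P.dLin b (P.dLin c α) = P.dLin c (P.dLin b α) := by
  obtain ⟨f, rfl⟩ := P.cls_surjective α
  rw [dLin_cls, dLin_cls, dLin_cls, dLin_cls]
  exact cls_congr fun z hz => pd_comm f.2 b c hz

/-- The family `f` is smooth and represents the element `α`. -/
def Rep (f : ℝ → Pt → ℝ) (α : P.Lin) : Prop := ∃ h : f ∈ P.smooth, P.cls ⟨f, h⟩ = α

variable {P}

namespace Rep

variable {f h : ℝ → Pt → ℝ} {α β : P.Lin}

theorem add (hf : P.Rep f α) (hh : P.Rep h β) : P.Rep (fun ε x => f ε x + h ε x) (α + β) := by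
  obtain ⟨mf, rfl⟩ := hf
  obtain ⟨mh, rfl⟩ := hh
  exact ⟨P.smooth.add_mem mf mh, rfl⟩

theorem mul (hf : P.Rep f α) (hh : P.Rep h β) : P.Rep (fun ε x => f ε x * h ε x) (α * β) := by
  obtain ⟨mf, rfl⟩ := hf
  obtain ⟨mh, rfl⟩ := hh
  exact ⟨P.smooth.mul_mem mf mh, rfl⟩

theorem neg (hf : P.Rep f α) : P.Rep (fun ε x => -f ε x) (-α) := by
  obtain ⟨mf, rfl⟩ := hf
  exact ⟨P.smooth.neg_mem mf, rfl⟩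

theorem sub (hf : P.Rep f α) (hh : P.Rep h β) : P.Rep (fun ε x => f ε x - h ε x) (α - β) := by
  obtain ⟨mf, rfl⟩ := hf
  obtain ⟨mh, rfl⟩ := hh
  exact ⟨P.smooth.sub_mem mf mh, rfl⟩

theorem const (r : ℝ) : P.Rep (fun _ _ => r) (algebraMap ℝ P.Lin r) :=
  ⟨P.smooth.algebraMap_mem r, rfl⟩

theorem sum {f : Fin 4 → ℝ → Pt → ℝ} {α : Fin 4 → P.Lin} (hf : ∀ i, P.Rep (f i) (α i)) :
    P.Rep (fun ε x => ∑ i, f i ε x) (∑ i, α i) := by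
  simp only [Fin.sum_univ_four]
  exact (((hf 0).add (hf 1)).add (hf 2)).add (hf 3)

theorem pd (c : Fin 4) (hf : P.Rep f α) :
    P.Rep (fun ε x => ConfFlat.pd c (fun y => f ε y) x) (P.dLin c α) := by
  obtain ⟨mf, rfl⟩ := hf
  exact ⟨pd_mem mf c, (P.dLin_cls c ⟨f, mf⟩).symm⟩

theorem congr (hf : P.Rep f α) (e : ∀ z ∈ P.dom, h z.1 z.2 = f z.1 z.2) : P.Rep h α := by
  obtain ⟨mf, rfl⟩ := hf
  exact ⟨mem_smooth_congr mf e, cls_congr e⟩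

theorem unique (hf : P.Rep f α) (hh : P.Rep h β) (e : ∀ z ∈ P.dom, f z.1 z.2 = h z.1 z.2) :
    α = β := by
  obtain ⟨mf, rfl⟩ := hf
  obtain ⟨mh, rfl⟩ := hh
  exact cls_congr e

theorem eqFirstOrder (hf : P.Rep f α) (hh : P.Rep h α) {x : Pt} (hx : x ∈ P.U) :
    EqFirstOrder (fun ε => f ε x) (fun ε => h ε x) := by
  obtain ⟨ms, hs⟩ := hf.sub hh
  rw [sub_self, cls_eq_zero] at hs
  simpa [EqFirstOrder] using hs x hx

theorem eq_zero (hf : P.Rep f α)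
    (h0 : ∀ x ∈ P.U, EqFirstOrder (fun ε => f ε x) (fun _ => 0)) : α = 0 := by
  obtain ⟨mf, rfl⟩ := hf
  exact cls_eq_zero.2 h0

theorem mem_firstOrder (hf : P.Rep f α) (h0 : ∀ x ∈ P.U, f 0 x = 0) : α ∈ P.firstOrder := by
  obtain ⟨mf, rfl⟩ := hf
  exact P.mem_firstOrder.2 ⟨_, h0, rfl⟩

end Rep

end Patch

/-! ### From families of spacetimes to formal spacetimes -/

namespace Patch

variable {P : Patch}

/-- The formal spacetime `G` represents the family of metrics `g` with velocities `u`. -/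
structure Represents (G : Spacetime P.Lin) (g : ℝ → MetricField) (u : ℝ → Field1) : Prop where
  d_eq : G.d = P.dLin
  metric : ∀ a b, P.Rep (fun ε x => g ε x a b) (G.g a b)
  inverse : ∀ a b, P.Rep (fun ε x => (g ε x)⁻¹ a b) (G.ginv a b)
  velocity : ∀ a, P.Rep (fun ε x => u ε x a) (G.u a)

theorem Rep.half {f : ℝ → Pt → ℝ} {α : P.Lin} (hf : P.Rep f α) :
    P.Rep (fun ε x => f ε x / 2) (α * algebraMap ℝ P.Lin (1 / 2)) :=
  (hf.mul (Rep.const _)).congr fun z _ => by ring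

theorem Rep.delta (a b : Fin 4) :
    P.Rep (fun _ _ => if a = b then 1 else 0) (if a = b then 1 else 0) := by
  split_ifs
  · simpa using Rep.const (P := P) 1
  · simpa using Rep.const (P := P) 0

/-- Componentwise representation of a family of covector fields. -/
def Rep1 (V : ℝ → Field1) (α : Fin 4 → P.Lin) : Prop :=
  ∀ a, P.Rep (fun ε x => V ε x a) (α a)

/-- Componentwise representation of a family of tensor fields of rank two. -/
def Rep2 (S : ℝ → Field2) (α : Fin 4 → Fin 4 → P.Lin) : Prop :=
  ∀ a b, P.Rep (fun ε x => S ε x a b) (α a b)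

/-- Componentwise representation of a family of tensor fields of rank three. -/
def Rep3 (S : ℝ → Field3) (α : Fin 4 → Fin 4 → Fin 4 → P.Lin) : Prop :=
  ∀ a b c, P.Rep (fun ε x => S ε x a b c) (α a b c)

namespace Represents

variable {G : Spacetime P.Lin} {g : ℝ → MetricField} {u : ℝ → Field1} (R : Represents G g u)

include R

theorem pd (c : Fin 4) {f : ℝ → Pt → ℝ} {α : P.Lin} (hf : P.Rep f α) :
    P.Rep (fun ε x => ConfFlat.pd c (fun y => f ε y) x) (G.d c α) := by
  rw [R.d_eq]
  exact hf.pd c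

theorem christoffel (a b c : Fin 4) :
    P.Rep (fun ε x => christoffel (g ε) x a b c) (G.chr a b c) :=
  (Rep.const _).mul <| Rep.sum fun e => (R.inverse a e).mul <|
    ((R.pd b (R.metric e c)).add (R.pd c (R.metric e b))).sub (R.pd e (R.metric b c))

theorem riemannUp (a b c d : Fin 4) :
    P.Rep (fun ε x => riemannUp (g ε) x a b c d) (G.riemUp a b c d) :=
  (((R.pd c (R.christoffel a b d)).sub (R.pd d (R.christoffel a b c))).add
    (Rep.sum fun e => (R.christoffel e b d).mul (R.christoffel a c e))).sub
    (Rep.sum fun e => (R.christoffel e b c).mul (R.christoffel a d e))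

theorem riemann (a b c d : Fin 4) :
    P.Rep (fun ε x => riemann (g ε) x a b c d) (G.riem a b c d) :=
  Rep.sum fun e => (R.metric a e).mul (R.riemannUp e b c d)

theorem ricci (a b : Fin 4) : P.Rep (fun ε x => ricci (g ε) x a b) (G.ricci a b) :=
  Rep.sum fun c => Rep.sum fun d => (R.inverse c d).mul (R.riemann c a d b)

theorem scalarCurv : P.Rep (fun ε x => scalarCurv (g ε) x) G.scalarCurv :=
  Rep.sum fun a => Rep.sum fun b => (R.inverse a b).mul (R.ricci a b)

theorem einstein : Rep2 (fun ε => einstein (g ε)) G.einstein := fun a b =>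
  (R.ricci a b).sub (((Rep.const _).mul R.scalarCurv).mul (R.metric a b))

theorem weyl (a b c d : Fin 4) : P.Rep (fun ε x => weyl (g ε) x a b c d) (G.weyl a b c d) :=
  ((R.riemann a b c d).sub ((Rep.const _).mul
    (((((R.metric a c).mul (R.ricci b d)).sub ((R.metric a d).mul (R.ricci b c))).sub
      ((R.metric b c).mul (R.ricci a d))).add ((R.metric b d).mul (R.ricci a c))))).add
    (((Rep.const _).mul R.scalarCurv).mul
      (((R.metric a c).mul (R.metric b d)).sub ((R.metric a d).mul (R.metric b c))))

theorem nabla1 {V : ℝ → Field1} {α : Fin 4 → P.Lin} (hV : Rep1 V α) :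
    Rep2 (fun ε => nabla1 (g ε) (V ε)) (G.nabla1 α) := fun c a =>
  (R.pd c (hV a)).sub (Rep.sum fun e => (R.christoffel e c a).mul (hV e))

theorem nabla2 {S : ℝ → Field2} {α : Fin 4 → Fin 4 → P.Lin} (hS : Rep2 S α) :
    Rep3 (fun ε => nabla2 (g ε) (S ε)) (G.nabla2 α) := fun c a b =>
  ((R.pd c (hS a b)).sub (Rep.sum fun e => (R.christoffel e c a).mul (hS e b))).sub
    (Rep.sum fun e => (R.christoffel e c b).mul (hS a e))

theorem nabla3 {S : ℝ → Field3} {α : Fin 4 → Fin 4 → Fin 4 → P.Lin} (hS : Rep3 S α)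
    (d c a b : Fin 4) :
    P.Rep (fun ε x => nabla3 (g ε) (S ε) x d c a b) (G.nabla3 α d c a b) :=
  (((R.pd d (hS c a b)).sub (Rep.sum fun e => (R.christoffel e d c).mul (hS e a b))).sub
    (Rep.sum fun e => (R.christoffel e d a).mul (hS c e b))).sub
    (Rep.sum fun e => (R.christoffel e d b).mul (hS c a e))

theorem low : Rep1 (fun ε => low (g ε) (u ε)) G.w := fun a =>
  Rep.sum fun b => (R.metric a b).mul (R.velocity b)

theorem hLow : Rep2 (fun ε => hLow (g ε) (u ε)) G.hLow := fun a b =>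
  (R.metric a b).add ((R.low a).mul (R.low b))

theorem hMix : Rep2 (fun ε => hMix (g ε) (u ε)) G.hMix := fun a b =>
  (Rep.delta a b).add ((R.velocity a).mul (R.low b))

theorem hUp : Rep2 (fun ε => hUp (g ε) (u ε)) G.hUp := fun a b =>
  (R.inverse a b).add ((R.velocity a).mul (R.velocity b))

theorem dot2 {S : ℝ → Field2} {α : Fin 4 → Fin 4 → P.Lin} (hS : Rep2 S α) :
    Rep2 (fun ε => dot2 (g ε) (u ε) (S ε)) (G.dot2 α) := fun a b =>
  Rep.sum fun e => (R.velocity e).mul (R.nabla2 hS e a b)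

theorem D0 {f : ℝ → Pt → ℝ} {α : P.Lin} (hf : P.Rep f α) :
    Rep1 (fun ε => D0 (g ε) (u ε) (f ε)) (G.D0 α) := fun a =>
  Rep.sum fun b => (R.hMix b a).mul (R.pd b hf)

theorem D1 {V : ℝ → Field1} {α : Fin 4 → P.Lin} (hV : Rep1 V α) :
    Rep2 (fun ε => D1 (g ε) (u ε) (V ε)) (G.D1 α) := fun c a =>
  Rep.sum fun p => Rep.sum fun q => ((R.hMix p c).mul (R.hMix q a)).mul (R.nabla1 hV p q)

theorem D2 {S : ℝ → Field2} {α : Fin 4 → Fin 4 → P.Lin} (hS : Rep2 S α) :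
    Rep3 (fun ε => D2 (g ε) (u ε) (S ε)) (G.D2 α) := fun c a b =>
  Rep.sum fun p => Rep.sum fun q => Rep.sum fun r =>
    (((R.hMix p c).mul (R.hMix q a)).mul (R.hMix r b)).mul (R.nabla2 hS p q r)

theorem D3 {S : ℝ → Field3} {α : Fin 4 → Fin 4 → Fin 4 → P.Lin} (hS : Rep3 S α)
    (d c a b : Fin 4) :
    P.Rep (fun ε x => D3 (g ε) (u ε) (S ε) x d c a b) (G.D3 α d c a b) :=
  Rep.sum fun o => Rep.sum fun p => Rep.sum fun q => Rep.sum fun r =>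
    ((((R.hMix o d).mul (R.hMix p c)).mul (R.hMix q a)).mul (R.hMix r b)).mul
      (R.nabla3 hS o p q r)

theorem lap2 {S : ℝ → Field2} {α : Fin 4 → Fin 4 → P.Lin} (hS : Rep2 S α) :
    Rep2 (fun ε => lap2 (g ε) (u ε) (S ε)) (G.lap2 α) := fun a b =>
  Rep.sum fun c => Rep.sum fun d => (R.hUp c d).mul (R.D3 (R.D2 hS) c d a b)

theorem div2 {S : ℝ → Field2} {α : Fin 4 → Fin 4 → P.Lin} (hS : Rep2 S α) :
    Rep1 (fun ε => div2 (g ε) (u ε) (S ε)) (G.div2 α) := fun a =>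
  Rep.sum fun b => Rep.sum fun c => (R.hUp b c).mul (R.D2 hS c a b)

theorem pstf {S : ℝ → Field2} {α : Fin 4 → Fin 4 → P.Lin} (hS : Rep2 S α) :
    Rep2 (fun ε => pstf (g ε) (u ε) (S ε)) (G.pstf α) := fun a b =>
  (Rep.sum fun c => Rep.sum fun d =>
    ((R.hMix c a).mul (R.hMix d b)).mul ((hS c d).add (hS d c)).half).sub
    (((Rep.const _).mul (R.hLow a b)).mul
      (Rep.sum fun c => Rep.sum fun d => (R.hUp c d).mul (hS c d)))

theorem acceleration : Rep1 (fun ε => acceleration (g ε) (u ε)) G.acceleration := fun a =>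
  Rep.sum fun e => (R.velocity e).mul (R.nabla1 R.low e a)

theorem expansion : P.Rep (fun ε x => expansion (g ε) (u ε) x) G.expansion :=
  Rep.sum fun a => Rep.sum fun b => (R.hUp a b).mul (R.D1 R.low a b)

theorem shear : Rep2 (fun ε => shear (g ε) (u ε)) G.shear := R.pstf (R.D1 R.low)

theorem density {T : ℝ → Field2} (hT : Rep2 T G.einstein) :
    P.Rep (fun ε x => density (T ε) (u ε) x) G.density :=
  Rep.sum fun a => Rep.sum fun b => ((hT a b).mul (R.velocity a)).mul (R.velocity b)

theorem pressure {T : ℝ → Field2} (hT : Rep2 T G.einstein) :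
    P.Rep (fun ε x => pressure (g ε) (T ε) (u ε) x) G.pressure :=
  (Rep.const _).mul (Rep.sum fun a => Rep.sum fun b => (R.hUp a b).mul (hT a b))

theorem heatFlux {T : ℝ → Field2} (hT : Rep2 T G.einstein) :
    Rep1 (fun ε => heatFlux (g ε) (T ε) (u ε)) G.heatFlux := fun a =>
  (Rep.sum fun c => Rep.sum fun d => ((R.hMix c a).mul (hT c d)).mul (R.velocity d)).neg

end Represents

end Patch

/-! ### Vorticity -/

theorem det_fin_four (M : Matrix (Fin 4) (Fin 4) ℝ) : M.det =
    let m : Fin 4 → Fin 4 → ℝ := fun i j => M 2 i * M 3 j - M 2 j * M 3 i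
    M 0 0 * (M 1 1 * m 2 3 - M 1 2 * m 1 3 + M 1 3 * m 1 2)
      - M 0 1 * (M 1 0 * m 2 3 - M 1 2 * m 0 3 + M 1 3 * m 0 2)
      + M 0 2 * (M 1 0 * m 1 3 - M 1 1 * m 0 3 + M 1 3 * m 0 1)
      - M 0 3 * (M 1 0 * m 1 2 - M 1 1 * m 0 2 + M 1 2 * m 0 1) := by
  rw [Matrix.det_succ_row_zero]
  simp only [Fin.sum_univ_four, Matrix.det_fin_three, Matrix.submatrix_apply]
  simp [Fin.succAbove]
  ring

theorem permSymbol_eq (a b c d : Fin 4) : permSymbol a b c d =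
    let δ : Fin 4 → Fin 4 → ℝ := fun i j => if i = j then 1 else 0
    let m : Fin 4 → Fin 4 → ℝ := fun i j => δ c i * δ d j - δ c j * δ d i
    δ a 0 * (δ b 1 * m 2 3 - δ b 2 * m 1 3 + δ b 3 * m 1 2)
      - δ a 1 * (δ b 0 * m 2 3 - δ b 2 * m 0 3 + δ b 3 * m 0 2)
      + δ a 2 * (δ b 0 * m 1 3 - δ b 1 * m 0 3 + δ b 3 * m 0 1)
      - δ a 3 * (δ b 0 * m 1 2 - δ b 1 * m 0 2 + δ b 2 * m 0 1) :=
  det_fin_four _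

namespace Spacetime

variable {A : Type*} [CommRing A] [Algebra ℝ A] (G : Spacetime A)

/-- The vorticity vector without its density factor `-√|det g|`. -/
def vorticityDual (a : Fin 4) : A := ∑ b, ∑ c, (∑ p, ∑ q, ∑ r,
  G.ginv a p * G.ginv b q * G.ginv c r * ∑ d, algebraMap ℝ A (permSymbol p q r d) * G.u d)
    * G.D1 G.w b c

/-- The projected velocity gradient `D_b u_c` with both indices raised. -/
def gradUp (q r : Fin 4) : A := ∑ b, ∑ c, G.ginv b q * G.ginv c r * G.D1 G.w b c

theorem vorticityDual_eq (a : Fin 4) : G.vorticityDual a = ∑ p, G.ginv a p *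
    ∑ q, ∑ r, (∑ d, algebraMap ℝ A (permSymbol p q r d) * G.u d) * G.gradUp q r := by
  have h1 : G.vorticityDual a = ∑ b, ∑ c, ∑ p, ∑ q, ∑ r,
      G.ginv a p * G.ginv b q * G.ginv c r *
        (∑ d, algebraMap ℝ A (permSymbol p q r d) * G.u d) * G.D1 G.w b c := by
    simp only [vorticityDual, Finset.sum_mul]
  have h2 : ∀ b, ∑ c, ∑ p, ∑ q, ∑ r, G.ginv a p * G.ginv b q * G.ginv c r *
        (∑ d, algebraMap ℝ A (permSymbol p q r d) * G.u d) * G.D1 G.w b c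
      = ∑ p, ∑ c, ∑ q, ∑ r, G.ginv a p * G.ginv b q * G.ginv c r *
        (∑ d, algebraMap ℝ A (permSymbol p q r d) * G.u d) * G.D1 G.w b c := fun b =>
    Finset.sum_comm
  rw [h1, Finset.sum_congr rfl fun b _ => h2 b, Finset.sum_comm]
  refine Finset.sum_congr rfl fun p _ => ?_
  rw [sum_rotate]
  simp_rw [Finset.mul_sum (a := G.ginv a p)]
  refine Finset.sum_congr rfl fun q _ => Finset.sum_congr rfl fun r _ => ?_
  generalize ∑ d, algebraMap ℝ A (permSymbol p q r d) * G.u d = y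
  simp only [gradUp, Finset.mul_sum]
  exact Finset.sum_congr rfl fun b _ => Finset.sum_congr rfl fun c _ => by ring

theorem cu_D1 (b : Fin 4) : G.cu (fun c => G.D1 G.w b c) = 0 := by
  have h : ∀ c, G.D1 G.w b c = G.proj2 (fun c b => G.nabla1 G.w b c) c b := fun c => by
    rw [proj2_swap]; rfl
  simp only [h, cu_proj2]

theorem cu_D1' (c : Fin 4) : G.cu (fun b => G.D1 G.w b c) = 0 := G.cu_proj2 _ c

theorem sum_gradUp (q : Fin 4) : ∑ r, G.gradUp q r * G.w r = 0 := by
  have h : ∑ r, G.gradUp q r * G.w r = ∑ b, G.ginv b q * G.cu fun c => G.D1 G.w b c := by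
    simp only [cu, ← G.ginv_w, gradUp, Fin.sum_univ_four]
    ring
  simp only [h, cu_D1, mul_zero, Finset.sum_const_zero]

theorem sum_gradUp' (r : Fin 4) : ∑ q, G.gradUp q r * G.w q = 0 := by
  have h : ∑ q, G.gradUp q r * G.w q = ∑ c, G.ginv c r * G.cu fun b => G.D1 G.w b c := by
    simp only [cu, ← G.ginv_w, gradUp, Fin.sum_univ_four]
    ring
  simp only [h, cu_D1', mul_zero, Finset.sum_const_zero]

theorem D1_eq_gradUp (b c : Fin 4) :
    G.D1 G.w b c = ∑ q, G.g b q * ∑ r, G.g c r * G.gradUp q r := by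
  have h : ∀ q, ∑ r, G.g c r * G.gradUp q r = ∑ b, G.ginv q b * G.D1 G.w b c := by
    intro q
    have h2 : ∀ r, G.gradUp q r = ∑ c, G.ginv r c * ∑ b, G.ginv q b * G.D1 G.w b c := by
      intro r
      simp only [gradUp, Finset.mul_sum]
      rw [Finset.sum_comm]
      exact Finset.sum_congr rfl fun c _ => Finset.sum_congr rfl fun b _ => by
        rw [G.ginv_symm q b, G.ginv_symm r c]; ring
    simp only [h2, G.mul_ginv_apply fun c => ∑ b, G.ginv q b * G.D1 G.w b c]
  simp only [h, G.mul_ginv_apply fun b => G.D1 G.w b c]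

/-- A congruence whose vorticity vector vanishes has a symmetric projected velocity gradient: the
vorticity vector is dual to the antisymmetric part, which is spatial. -/
theorem D1_symm_of_vorticityDual (h : ∀ a, G.vorticityDual a = 0) (b c : Fin 4) :
    G.D1 G.w b c = G.D1 G.w c b := by
  have hE : ∀ p, ∑ q, ∑ r, (∑ d, algebraMap ℝ A (permSymbol p q r d) * G.u d) * G.gradUp q r
      = 0 := by
    intro p
    rw [← G.mul_ginv_apply (fun p => ∑ q, ∑ r,
      (∑ d, algebraMap ℝ A (permSymbol p q r d) * G.u d) * G.gradUp q r) p]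
    simp only [← vorticityDual_eq, h, mul_zero, Finset.sum_const_zero]
  have e0 := hE 0
  have e1 := hE 1
  have e2 := hE 2
  have e3 := hE 3
  simp [permSymbol_eq, Fin.sum_univ_four] at e0 e1 e2 e3
  have hu := G.cu_w
  have s0 := G.sum_gradUp 0
  have s1 := G.sum_gradUp 1
  have s2 := G.sum_gradUp 2
  have s3 := G.sum_gradUp 3
  have t0 := G.sum_gradUp' 0
  have t1 := G.sum_gradUp' 1
  have t2 := G.sum_gradUp' 2
  have t3 := G.sum_gradUp' 3
  simp only [cu, Fin.sum_univ_four] at hu s0 s1 s2 s3 t0 t1 t2 t3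
  -- Expand `-A^{ij} = A^{ij} u^l u_l` for the antisymmetric part `A`, and eliminate the terms in `u_i`
  -- and `u_j` by `A^{il} u_l = 0`; what is left are the dual components `hE`.
  have h01 : G.gradUp 0 1 = G.gradUp 1 0 := by
    linear_combination (G.gradUp 0 1 - G.gradUp 1 0) * hu + G.w 2 * e3 - G.w 3 * e2
      - G.u 1 * (s0 - t0) + G.u 0 * (s1 - t1)
  have h02 : G.gradUp 0 2 = G.gradUp 2 0 := by
    linear_combination (G.gradUp 0 2 - G.gradUp 2 0) * hu - G.w 1 * e3 + G.w 3 * e1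
      - G.u 2 * (s0 - t0) + G.u 0 * (s2 - t2)
  have h03 : G.gradUp 0 3 = G.gradUp 3 0 := by
    linear_combination (G.gradUp 0 3 - G.gradUp 3 0) * hu + G.w 1 * e2 - G.w 2 * e1
      - G.u 3 * (s0 - t0) + G.u 0 * (s3 - t3)
  have h12 : G.gradUp 1 2 = G.gradUp 2 1 := by
    linear_combination (G.gradUp 1 2 - G.gradUp 2 1) * hu - G.w 3 * e0 + G.w 0 * e3
      - G.u 2 * (s1 - t1) + G.u 1 * (s2 - t2)
  have h13 : G.gradUp 1 3 = G.gradUp 3 1 := by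
    linear_combination (G.gradUp 1 3 - G.gradUp 3 1) * hu - G.w 0 * e2 + G.w 2 * e0
      - G.u 3 * (s1 - t1) + G.u 1 * (s3 - t3)
  have h23 : G.gradUp 2 3 = G.gradUp 3 2 := by
    linear_combination (G.gradUp 2 3 - G.gradUp 3 2) * hu + G.w 0 * e1 - G.w 1 * e0
      - G.u 3 * (s2 - t2) + G.u 2 * (s3 - t3)
  have hW : ∀ q r, G.gradUp q r = G.gradUp r q := by
    intro q r
    fin_cases q <;> fin_cases r <;>
      first
      | rfl
      | exact h01 | exact h02 | exact h03 | exact h12 | exact h13 | exact h23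
      | exact h01.symm | exact h02.symm | exact h03.symm | exact h12.symm | exact h13.symm
      | exact h23.symm
  rw [D1_eq_gradUp, D1_eq_gradUp]
  simp only [Finset.mul_sum]
  rw [Finset.sum_comm]
  exact Finset.sum_congr rfl fun q _ => Finset.sum_congr rfl fun r _ => by rw [hW r q]; ring

end Spacetime

namespace Patch.Represents

variable {P : Patch} {G : Spacetime P.Lin} {g : ℝ → MetricField} {u : ℝ → Field1}
  (R : Represents G g u)

include R

theorem vorticityDual (a : Fin 4) : P.Rep (fun ε x => ∑ b, ∑ c, (∑ p, ∑ q, ∑ r,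
      (g ε x)⁻¹ a p * (g ε x)⁻¹ b q * (g ε x)⁻¹ c r * ∑ d, permSymbol p q r d * u ε x d)
        * ConfFlat.D1 (g ε) (u ε) (ConfFlat.low (g ε) (u ε)) x b c) (G.vorticityDual a) :=
  Rep.sum fun b => Rep.sum fun c => (Rep.sum fun p => Rep.sum fun q => Rep.sum fun r =>
    (((R.inverse a p).mul (R.inverse b q)).mul (R.inverse c r)).mul
      (Rep.sum fun d => (Rep.const _).mul (R.velocity d))).mul (R.D1 R.low b c)

omit R in
theorem vorticity_eq_mul (g : MetricField) (u : Field1) (x : Pt) (a : Fin 4) :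
    vorticity g u x a = -Real.sqrt |(g x).det| * ∑ b, ∑ c, (∑ p, ∑ q, ∑ r,
      (g x)⁻¹ a p * (g x)⁻¹ b q * (g x)⁻¹ c r * ∑ d, permSymbol p q r d * u x d)
        * ConfFlat.D1 g u (ConfFlat.low g u) x b c := by
  rw [vorticity, Finset.mul_sum]
  refine Finset.sum_congr rfl fun b _ => ?_
  rw [Finset.mul_sum]
  refine Finset.sum_congr rfl fun c _ => ?_
  rw [← mul_assoc, epsUp]
  congr 1
  simp only [epsLow, Finset.mul_sum]
  exact Finset.sum_congr rfl fun p _ => Finset.sum_congr rfl fun q _ =>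
    Finset.sum_congr rfl fun r _ => Finset.sum_congr rfl fun d _ => by ring

/-- The density factor `√|det g|` is bounded away from zero, so that it may be dropped. -/
theorem vorticityDual_eq_zero (hdet : ∀ x ∈ P.U, (g 0 x).det ≠ 0)
    (h : ∀ x ∈ P.U, ∀ i, EqFirstOrder (fun ε => vorticity (g ε) (u ε) x i) (fun _ => 0))
    (a : Fin 4) : G.vorticityDual a = 0 := by
  refine (R.vorticityDual a).eq_zero fun x hx => ?_
  have hz := P.zero_mem_dom hx
  have hcg : ∀ i j, ContinuousAt (fun ε => g ε x i j) 0 := fun i j => by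
    obtain ⟨hm, _⟩ := R.metric i j
    exact ContinuousAt.comp (f := fun ε : ℝ => (ε, x)) (differentiableAt hm hz).continuousAt
      (by fun_prop)
  have hcM : ContinuousAt (fun ε => g ε x) 0 :=
    continuousAt_pi.2 fun i => continuousAt_pi.2 fun j => hcg i j
  have hdetc : ContinuousAt (fun ε => (g ε x).det) 0 :=
    ContinuousAt.comp (f := fun ε => g ε x) (g := Matrix.det)
      (Continuous.matrix_det continuous_id).continuousAt hcM
  have hs : ContinuousAt (fun ε => -Real.sqrt |(g ε x).det|) 0 :=
    (Real.continuous_sqrt.continuousAt.comp hdetc.abs).neg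
  have hs0 : -Real.sqrt |(g 0 x).det| ≠ 0 :=
    neg_ne_zero.2 (Real.sqrt_pos.2 (abs_pos.2 (hdet x hx))).ne'
  have hO := (hs.inv₀ hs0).tendsto.isBigO_one ℝ
  have hlo := hO.mul_isLittleO (h x hx a)
  have hne : ∀ᶠ ε in 𝓝 (0 : ℝ), -Real.sqrt |(g ε x).det| ≠ 0 := hs.eventually_ne hs0
  unfold EqFirstOrder
  refine hlo.congr' ?_ (by simp)
  filter_upwards [hne] with ε hε
  rw [vorticity_eq_mul, sub_zero, sub_zero]
  exact inv_mul_cancel_left₀ hε _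

end Patch.Represents

/-! ### Spacetimes at a point -/

/-- The properties of a Lorentzian metric and a unit timelike vector that tensor algebra at a
point uses. -/
structure IsPointed (M : Matrix (Fin 4) (Fin 4) ℝ) (v : Fin 4 → ℝ) : Prop where
  symm : ∀ a b, M a b = M b a
  det_ne_zero : M.det ≠ 0
  unit : ∑ a, ∑ b, M a b * v a * v b = -1

theorem isPointed_of_isLorentzian {M : Matrix (Fin 4) (Fin 4) ℝ} {v : Fin 4 → ℝ}
    (h : IsLorentzian M) (hv : ∑ a, ∑ b, M a b * v a * v b = -1) : IsPointed M v := by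
  obtain ⟨Q, hQ, rfl⟩ := h
  refine ⟨fun a b => ?_, ?_, hv⟩
  · have : (Q.transpose * Matrix.diagonal ![-1, 1, 1, 1] * Q).transpose
        = Q.transpose * Matrix.diagonal ![-1, 1, 1, 1] * Q := by
      simp [Matrix.transpose_mul, Matrix.mul_assoc]
    exact congrFun (congrFun this b) a
  · have := hQ.ne_zero
    simp [Matrix.det_mul, Matrix.det_transpose, Matrix.det_diagonal, Fin.prod_univ_four, this]

namespace IsPointed

variable {M : Matrix (Fin 4) (Fin 4) ℝ} {v : Fin 4 → ℝ} (h : IsPointed M v)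

include h

theorem inv_mul (a c : Fin 4) : ∑ b, M⁻¹ a b * M b c = if a = c then 1 else 0 := by
  have h1 := Matrix.nonsing_inv_mul M (isUnit_iff_ne_zero.2 h.det_ne_zero)
  have h2 := congrFun (congrFun h1 a) c
  rwa [Matrix.mul_apply, Matrix.one_apply] at h2

theorem inv_symm (a b : Fin 4) : M⁻¹ a b = M⁻¹ b a := by
  have h1 : M.transpose = M := by ext i j; exact h.symm j i
  have h2 := Matrix.transpose_nonsing_inv M
  rw [h1] at h2
  exact congrFun (congrFun h2 b) a

/-- The tangent space at a point as a formal spacetime, in which the derivations vanish. -/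
def formal : Spacetime ℝ where
  d _ := 0
  g a b := M a b
  ginv a b := M⁻¹ a b
  u := v
  d_comm _ _ _ := rfl
  g_symm := h.symm
  ginv_symm := h.inv_symm
  ginv_mul := h.inv_mul
  unit := h.unit

end IsPointed

theorem pstf_eq_formal {g : MetricField} {u : Field1} {x : Pt} (h : IsPointed (g x) (u x))
    (S : Field2) : pstf g u S x = h.formal.pstf (S x) := by
  funext a b
  simp only [pstf, Spacetime.pstf, Algebra.algebraMap_self, RingHom.id_apply,
    div_eq_mul_one_div (_ + _) (2 : ℝ)]
  rfl

theorem D1_eq_formal {g : MetricField} {u : Field1} {x : Pt} (h : IsPointed (g x) (u x))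
    (V : Field1) : D1 g u V x = h.formal.proj2 (nabla1 g V x) := rfl

theorem Spacetime.pstf_proj2_hLow {A : Type*} [CommRing A] [Algebra ℝ A] (G : Spacetime A) (y : A)
    (a b : Fin 4) : G.pstf (G.proj2 fun a b => y * G.hLow a b) a b = 0 := by
  have h1 : ∀ b, G.cu (fun a => y * G.hLow a b) = 0 := fun b => by rw [cu_smul, cu_hLow, mul_zero]
  have hs : ∀ a b, y * G.hLow a b = y * G.hLow b a := fun a b => by rw [G.hLow_symm]
  have h2 : ∀ a, G.cu (fun b => y * G.hLow a b) = 0 := fun a => by simp only [hs a, h1]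
  have h3 : (G.proj2 fun a b => y * G.hLow a b) = fun a b => y * G.hLow a b :=
    funext fun a => funext fun b => G.proj2_of_spatial h1 h2 a b
  rw [h3, G.pstf_of_spatial hs h1, tr_smul, tr_hLow]
  linear_combination -y * G.hLow a b * three_third (A := A)

/-! ### The shear of the background -/

/-- The derivative of a product with a factor that does not depend on the coordinate `x^c`. -/
theorem pd_mul_of_invariant {c : Fin 4} {m f h : Pt → ℝ} {x : Pt} (hm : DifferentiableAt ℝ m x)
    (hinv : ∀ t : ℝ, m (x + t • Pi.single c 1) = m x) (hf : DifferentiableAt ℝ f x)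
    (e : h =ᶠ[𝓝 x] fun y => m y * f y) : pd c h x = m x * pd c f x := by
  have h1 : fderiv ℝ m x (Pi.single c 1) = 0 := by
    rw [← hm.lineDeriv_eq_fderiv, lineDeriv]
    simp [hinv]
  rw [pd, e.fderiv_eq, pd, fderiv_fun_mul hm hf]
  simp [h1]

theorem pd_eq_zero_of_eventuallyEq {c : Fin 4} {f : Pt → ℝ} {r : ℝ} {x : Pt}
    (e : f =ᶠ[𝓝 x] fun _ => r) : pd c f x = 0 := by
  rw [pd, e.fderiv_eq]
  simp

/-- The spatial FLRW metric components divided by `g_{11}`; they do not depend on time. -/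
def flrwRatio (k : ℝ) (i : Fin 4) (y : Pt) : ℝ :=
  (![0, 1, y 1 ^ 2 * (1 - k * y 1 ^ 2), y 1 ^ 2 * (1 - k * y 1 ^ 2) * Real.sin (y 2) ^ 2] :
    Fin 4 → ℝ) i

theorem flrw_of_ne (a : ℝ → ℝ) (k : ℝ) (y : Pt) {i j : Fin 4} (h : i ≠ j) : flrw a k y i j = 0 :=
  Matrix.diagonal_apply_ne _ h

theorem flrw_zero_zero (a : ℝ → ℝ) (k : ℝ) (y : Pt) : flrw a k y 0 0 = -1 :=
  Matrix.diagonal_apply_eq _ _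

theorem flrw_eq_ratio {a : ℝ → ℝ} {k : ℝ} {y : Pt} (hy : y ∈ flrwDomain a k) {i : Fin 4}
    (hi : i ≠ 0) : flrw a k y i i = flrwRatio k i y * flrw a k y 1 1 := by
  have h := hy.2.2.1.ne'
  rw [flrw, Matrix.diagonal_apply_eq, Matrix.diagonal_apply_eq, flrwRatio]
  fin_cases i
  · exact absurd rfl hi
  · simp
  · simp
    generalize 1 - k * y 1 ^ 2 = r at h ⊢
    field_simp
  · simp
    generalize 1 - k * y 1 ^ 2 = r at h ⊢
    field_simp

theorem flrw_one_one_ne {a : ℝ → ℝ} {k : ℝ} {y : Pt} (hy : y ∈ flrwDomain a k) :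
    flrw a k y 1 1 ≠ 0 := by
  rw [flrw, Matrix.diagonal_apply_eq]
  exact (div_pos (pow_pos hy.1 2) hy.2.2.1).ne'

/-- The comoving velocity of an FLRW spacetime is free of shear: `∇_a u_b` is a multiple of
`h_{ab}`, as the spatial metric only changes in time by an overall factor. -/
theorem shear_flrw {a : ℝ → ℝ} {k : ℝ} {U : Set Pt} {g : MetricField} {u : Field1}
    (hU : IsOpen U) (hsub : U ⊆ flrwDomain a k) (hg : ∀ x ∈ U, g x = flrw a k x)
    (hu : ∀ x ∈ U, u x = Pi.single 0 1) {x : Pt} (hx : x ∈ U)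
    (hd : DifferentiableAt ℝ (fun y => g y 1 1) x) (hp : IsPointed (g x) (u x)) (i j : Fin 4) :
    shear g u x i j = 0 := by
  have hev : ∀ᶠ y in 𝓝 x, y ∈ U := hU.mem_nhds hx
  have hlow : ∀ y ∈ U, ∀ i, low g u y i = if i = 0 then -1 else 0 := by
    intro y hy i
    rw [low, hg y hy, hu y hy]
    simp only [Pi.single_apply, mul_ite, mul_one, mul_zero, Finset.sum_ite_eq', Finset.mem_univ,
      if_true]
    split_ifs with h
    · rw [h, flrw_zero_zero]
    · exact flrw_of_ne _ _ _ h
  -- Only `∂_0 g_{ij}` with `i` and `j` spatial survives in `Γ^0_{ij}`.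
  have hoff : ∀ c i j, i ≠ j → pd c (fun y => g y i j) x = 0 := fun c i j hij =>
    pd_eq_zero_of_eventuallyEq (r := 0) (hev.mono fun y hy => by
      simp only [hg y hy]; exact flrw_of_ne _ _ _ hij)
  have h00 : ∀ c, pd c (fun y => g y 0 0) x = 0 := fun c =>
    pd_eq_zero_of_eventuallyEq (r := -1) (hev.mono fun y hy => by
      simp only [hg y hy]; exact flrw_zero_zero _ _ _)
  have h0 : ∀ c i, pd c (fun y => g y 0 i) x = 0 := fun c i => by
    by_cases hi : 0 = i
    · rw [← hi]; exact h00 c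
    · exact hoff c 0 i hi
  have hratio : ∀ i, i ≠ 0 →
      pd 0 (fun y => g y i i) x = flrwRatio k i x * pd 0 (fun y => g y 1 1) x := by
    intro i hi
    refine pd_mul_of_invariant (m := flrwRatio k i) ?_ ?_ hd
      (hev.mono fun y hy => by simp only [hg y hy]; exact flrw_eq_ratio (hsub hy) hi)
    · unfold flrwRatio
      fin_cases i <;> simp <;> fun_prop
    · intro t
      simp [flrwRatio]
  -- The row `g^{0d}` of the inverse metric is `-δ^{0d}`.
  have hinv : ∀ d, (g x)⁻¹ 0 d = if d = 0 then -1 else 0 := by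
    intro d
    have h := hp.inv_mul 0 d
    rw [Finset.sum_eq_single d (fun b _ hb => by
      rw [hg x hx, flrw_of_ne a k x hb, mul_zero]) (by simp)] at h
    by_cases hd0 : d = 0
    · subst hd0
      nth_rewrite 2 [hg x hx] at h
      rw [flrw_zero_zero, if_pos rfl] at h
      rw [if_pos rfl]
      linarith
    · rw [if_neg (Ne.symm hd0)] at h
      rw [if_neg hd0]
      refine (mul_eq_zero.1 h).resolve_right fun h2 => ?_
      refine hp.det_ne_zero (Matrix.det_eq_zero_of_row_eq_zero d fun j => ?_)
      by_cases hj : d = j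
      · rw [← hj]; exact h2
      · rw [hg x hx]; exact flrw_of_ne a k x hj
  have hΓ : ∀ c i, christoffel g x 0 c i = 1 / 2 * pd 0 (fun y => g y c i) x := by
    intro c i
    simp only [christoffel, hinv, ite_mul, zero_mul, Finset.sum_ite_eq', Finset.mem_univ, if_true,
      h0]
    ring
  obtain ⟨y, hy⟩ : ∃ y, y = 1 / 2 * (pd 0 (fun y => g y 1 1) x / g x 1 1) := ⟨_, rfl⟩
  have hK : nabla1 g (low g u) x = fun c i => y * hp.formal.hLow c i := by
    funext c i
    have hlx : ∀ i, hp.formal.w i = if i = 0 then -1 else 0 := hlow x hx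
    have hd0 : pd c (fun y => low g u y i) x = 0 :=
      pd_eq_zero_of_eventuallyEq (hev.mono fun y hy => hlow y hy i)
    have hh : hp.formal.hLow c i = g x c i + hp.formal.w c * hp.formal.w i := rfl
    rw [nabla1, hd0]
    simp only [hlow x hx, mul_ite, mul_zero, Finset.sum_ite_eq', Finset.mem_univ, if_true, hΓ, hh,
      hlx]
    by_cases hci : c = i
    · subst hci
      by_cases hc : c = 0
      · subst hc
        rw [h00, hg x hx, flrw_zero_zero]
        simp
      · rw [hratio c hc, hy, hg x hx, flrw_eq_ratio (hsub hx) hc]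
        have := flrw_one_one_ne (hsub hx)
        simp only [if_neg hc]
        field_simp
        ring
    · rw [hoff 0 c i hci, hg x hx, flrw_of_ne a k x hci]
      by_cases hc : c = 0
      · rw [if_neg (fun hi => hci (hc.trans hi.symm))]
        simp
      · rw [if_neg hc]
        simp
  rw [shear, pstf_eq_formal hp, D1_eq_formal hp, hK, Spacetime.pstf_proj2_hLow]

/-! ### The formal spacetime of a perturbation -/

namespace Patch

variable {P : Patch}

theorem det_mem {M : ℝ → Pt → Matrix (Fin 4) (Fin 4) ℝ}
    (hM : ∀ i j, (fun ε x => M ε x i j) ∈ P.smooth) : (fun ε x => (M ε x).det) ∈ P.smooth := by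
  change ContDiffOn ℝ ∞ (fun z : ℝ × Pt => (M z.1 z.2).det) P.dom
  simp only [Matrix.det_apply']
  exact ContDiffOn.sum fun σ _ => contDiffOn_const.mul
    (contDiffOn_prod fun i _ => contDiffOn (hM (σ i) i))

theorem inv_mem {M : ℝ → Pt → Matrix (Fin 4) (Fin 4) ℝ}
    (hM : ∀ i j, (fun ε x => M ε x i j) ∈ P.smooth)
    (hdet : ∀ z ∈ P.dom, (M z.1 z.2).det ≠ 0) (i j : Fin 4) :
    (fun ε x => (M ε x)⁻¹ i j) ∈ P.smooth := by
  have hadj : (fun ε x => (M ε x).adjugate i j) ∈ P.smooth := by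
    simp only [Matrix.adjugate_apply]
    refine det_mem fun k l => ?_
    simp only [Matrix.updateRow_apply]
    split_ifs
    · exact P.smooth.algebraMap_mem _
    · exact hM k l
  have h := ((contDiffOn (det_mem hM)).inv hdet).mul (contDiffOn hadj)
  refine h.congr fun z _ => ?_
  change (M z.1 z.2)⁻¹ i j = (M z.1 z.2).det⁻¹ * (M z.1 z.2).adjugate i j
  rw [Matrix.inv_def, Ring.inverse_eq_inv', Matrix.smul_apply, smul_eq_mul]

/-- A smooth family of metrics and unit timelike velocities is represented by a formal
spacetime. -/
theorem exists_represents {g : ℝ → MetricField} {u : ℝ → Field1}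
    (hg : ∀ i j, (fun ε x => g ε x i j) ∈ P.smooth) (hu : ∀ i, (fun ε x => u ε x i) ∈ P.smooth)
    (hp : ∀ z ∈ P.dom, IsPointed (g z.1 z.2) (u z.1 z.2)) :
    ∃ G : Spacetime P.Lin, Represents G g u := by
  have hi := inv_mem hg fun z hz => (hp z hz).det_ne_zero
  have rg : ∀ i j, P.Rep (fun ε x => g ε x i j) (P.cls ⟨_, hg i j⟩) := fun i j => ⟨hg i j, rfl⟩
  have ri : ∀ i j, P.Rep (fun ε x => (g ε x)⁻¹ i j) (P.cls ⟨_, hi i j⟩) := fun i j => ⟨hi i j, rfl⟩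
  have ru : ∀ i, P.Rep (fun ε x => u ε x i) (P.cls ⟨_, hu i⟩) := fun i => ⟨hu i, rfl⟩
  exact ⟨{
    d := P.dLin
    g := fun i j => P.cls ⟨_, hg i j⟩
    ginv := fun i j => P.cls ⟨_, hi i j⟩
    u := fun i => P.cls ⟨_, hu i⟩
    d_comm := P.dLin_comm
    g_symm := fun a b => cls_congr fun z hz => (hp z hz).symm a b
    ginv_symm := fun a b => cls_congr fun z hz => (hp z hz).inv_symm a b
    ginv_mul := fun a c => by
      refine Rep.unique (Rep.sum fun b => (ri a b).mul (rg b c)) (Rep.delta a c) fun z hz => ?_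
      exact (hp z hz).inv_mul a c
    unit := by
      have h1 := Rep.const (P := P) (-1)
      rw [map_neg, map_one] at h1
      exact Rep.unique
        (Rep.sum fun a => Rep.sum fun b => ((rg a b).mul (ru a)).mul (ru b)) h1
        fun z hz => (hp z hz).unit }, rfl, rg, ri, ru⟩

end Patch

end Formal

end

theorem proposition4 (a : ℝ → ℝ) (k ε₀ : ℝ) (U : Set ConfFlat.Pt)
    (g : ℝ → ConfFlat.MetricField) (u : ℝ → ConfFlat.Field1) (T : ℝ → ConfFlat.Field2)
    (hpert : ConfFlat.IsFLRWPerturbation a k ε₀ U g u T)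
    (hflat : ConfFlat.IsConformallyFlat U g)
    (htensor : ConfFlat.IsTensorMode U g u T) :
    -- the shear is spatial, symmetric and trace-free
    (∀ ε ∈ Set.Ioo (-ε₀) ε₀, ∀ x ∈ U,
      (∀ i j : Fin 4, ConfFlat.shear (g ε) (u ε) x i j = ConfFlat.shear (g ε) (u ε) x j i) ∧
      (∀ i : Fin 4, ∑ j, ConfFlat.shear (g ε) (u ε) x i j * u ε x j = 0) ∧
      ∑ i, ∑ j, (g ε x)⁻¹ i j * ConfFlat.shear (g ε) (u ε) x i j = 0) ∧
    -- the shear is transverse to first order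
    (∀ x ∈ U, ∀ i : Fin 4, ConfFlat.EqFirstOrder
      (fun ε => ConfFlat.div2 (g ε) (u ε) (ConfFlat.shear (g ε) (u ε)) x i) (fun _ => 0)) ∧
    -- the wave equation to first order
    (∀ x ∈ U, ∀ i j : Fin 4, ConfFlat.EqFirstOrder
      (fun ε => ConfFlat.shearDDot (g ε) (u ε) x i j
        - ConfFlat.lap2 (g ε) (u ε) (ConfFlat.shear (g ε) (u ε)) x i j)
      (fun ε => -ConfFlat.expansion (g ε) (u ε) x * ConfFlat.shearDot (g ε) (u ε) x i j
        + ((1 / 3) * ConfFlat.expansion (g ε) (u ε) x ^ 2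
            - (7 / 6) * ConfFlat.density (T ε) (u ε) x
            + (1 / 2) * ConfFlat.pressure (g ε) (T ε) (u ε) x)
          * ConfFlat.shear (g ε) (u ε) x i j)) := by
  have hp : ∀ ε ∈ Set.Ioo (-ε₀) ε₀, ∀ x ∈ U, Formal.IsPointed (g ε x) (u ε x) :=
    fun ε hε x hx => Formal.isPointed_of_isLorentzian (hpert.lorentzian ε hε x hx)
      (hpert.unit_timelike ε hε x hx)
  refine ⟨fun ε hε x hx => ?_, ?_⟩
  · have h := hp ε hε x hx
    rw [ConfFlat.shear, Formal.pstf_eq_formal h]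
    refine ⟨h.formal.pstf_symm _, fun i => ?_, h.formal.tr_pstf _⟩
    rw [← h.formal.cu_pstf (ConfFlat.D1 (g ε) (u ε) (ConfFlat.low (g ε) (u ε)) x) i]
    exact Finset.sum_congr rfl fun j _ => by rw [h.formal.pstf_symm _ i j, mul_comm]; rfl
  · let P : Formal.Patch := ⟨ε₀, U, hpert.pos, hpert.isOpen⟩
    have h0 : (0 : ℝ) ∈ Set.Ioo (-ε₀) ε₀ := ⟨neg_lt_zero.2 hpert.pos, hpert.pos⟩
    obtain ⟨G, R⟩ := Formal.Patch.exists_represents (P := P) hpert.smooth_metric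
      hpert.smooth_velocity fun z hz => hp z.1 hz.1 z.2 hz.2
    have hT : Formal.Patch.Rep2 (P := P) T G.einstein := fun i j =>
      (R.einstein i j).congr fun z hz => (hpert.einstein_eq z.1 hz.1 z.2 hz.2 i j).symm
    have M : G.IsTensorMode P.firstOrder :=
      { mul_eq_zero := fun x hx y hy => P.firstOrder_mul hx hy
        d_mem := fun c x hx => by rw [R.d_eq]; exact P.dLin_mem c hx
        shear_mem := fun i j => (R.shear i j).mem_firstOrder fun x hx =>
          Formal.shear_flrw hpert.isOpen hpert.subset_domain hpert.background_metric
            hpert.background_velocity hx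
            (Formal.Patch.hasFDerivAt_slice (P := P) (f := fun ε x => g ε x 1 1)
              (hpert.smooth_metric 1 1) (P.zero_mem_dom hx)).differentiableAt
            (hp 0 h0 x hx) i j
        weyl_eq := fun i j l m => (R.weyl i j l m).eq_zero fun x hx => hflat x hx i j l m
        acceleration_eq := fun i => (R.acceleration i).eq_zero fun x hx =>
          htensor.acceleration_eq x hx i
        vorticity_free := G.D1_symm_of_vorticityDual <| R.vorticityDual_eq_zero
          (fun x hx => (hp 0 h0 x hx).det_ne_zero) htensor.vorticity_eq
        heatFlux_eq := fun i => (R.heatFlux hT i).eq_zero fun x hx => htensor.heatFlux_eq x hx i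
        grad_expansion := fun i => (R.D0 R.expansion i).eq_zero fun x hx =>
          htensor.grad_expansion x hx i
        grad_density := fun i => (R.D0 (R.density hT) i).eq_zero fun x hx =>
          htensor.grad_density x hx i
        grad_pressure := fun i => (R.D0 (R.pressure hT) i).eq_zero fun x hx =>
          htensor.grad_pressure x hx i }
    refine ⟨fun x hx i => ?_, fun x hx i j => ?_⟩
    · have h1 := R.div2 R.shear i
      have h2 := Formal.Patch.Rep.const (P := P) 0
      rw [map_zero] at h2
      rw [M.div2_shear] at h1
      exact h1.eqFirstOrder h2 hx
    · have h1 := (R.pstf (R.dot2 (R.dot2 R.shear)) i j).sub (R.lap2 R.shear i j)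
      rw [M.wave_equation, sq] at h1
      have h2 := (R.expansion.neg.mul (R.pstf (R.dot2 R.shear) i j)).add
        (((((Formal.Patch.Rep.const (1 / 3)).mul (R.expansion.mul R.expansion)).sub
          ((Formal.Patch.Rep.const (7 / 6)).mul (R.density hT))).add
          ((Formal.Patch.Rep.const (1 / 2)).mul (R.pressure hT))).mul (R.shear i j))
      have h3 := h1.eqFirstOrder h2 hx
      simp only [← sq] at h3
      exact h3
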